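/- Let $d\ge 2$, let $\Omega\subset\mathbb R^d$ be a bounded open set, and let $D$ be an open set (not necessarily connected) with boundary of class $\mathcal C^2$ and $\overline D\subset\Omega$. Let $\nu$ be the unit normal on $\partial D$ pointing out of $D$, let $ds$ be the surface measure on $\partial D$, and let $\gamma\in L^\infty(\partial D)$ be real-valued with constants $0<\gamma_{\min}\le\gamma(x)\le\gamma_{\max}$ for a.e. $x\in\partial D$. All function spaces consist of complex-valued functions, $H^1_0(\Omega)$ is the closure of $C_c^\infty(\Omega)$ in $H^1(\Omega)$, and $(\cdot,\cdot)$ is the inner product of $L^2(\partial D)$, linear in its first argument. Then every $w\in H^1_0(\Omega)$ has a unique trace $w|_{\partial D}\in L^2(\partial D)$ (the limit in $L^2(\partial D)$ of the restrictions to $\partial D$ of functions in $C^\infty(\Omega)\cap H^1(\Omega)$ that converge to $w$ in $H^1(\Omega)$), and for every $h\in L^2(\partial D)$ there is a unique weak solution $w=w_h\in H^1_0(\Omega)$ of $$-\Delta w=0\ \text{ in }\ \Omega\setminus\partial D,\qquad [\![\partial_\nu w]\!]\big|_{\partial D}:=(\partial_\nu w^+-\partial_\nu w^-)\big|_{\partial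 D}=\gamma h .$$ Here $+$ and $-$ refer to $\Omega\setminus\overline D$ and $D$, and the normal derivatives are understood through Green's identity, that is, for $\varphi\in H^1_0(\Omega)$, $$\langle\partial_\nu w^-,\varphi\rangle=\int_D\nabla w\cdot\nabla\overline\varphi\,dx,\qquad \langle\partial_\nu w^+,\varphi\rangle=-\int_{\Omega\setminus\overline D}\nabla w\cdot\nabla\overline\varphi\,dx,$$ and the jump condition means $\langle\partial_\nu w^+,\varphi\rangle-\langle\partial_\nu w^-,\varphi\rangle=\int_{\partial D}\gamma h\,\overline\varphi\,ds$ for all $\varphi\in H^1_0(\Omega)$. Moreover, $Th=\gamma\,\bigl[h-w_h|_{\partial D}\bigr]$ defines a bounded linear operator $T:L^2(\partial D)\to L^2(\partial D)$, and $T$ is coercive: for all $h\in L^2(\partial D)$, $$(Th,h)=\int_{\partial D}\gamma|h|^2\,ds+\int_\Omega|\nabla w_h|^2\,dx\ \ge\ \gamma_{\min}\,\|h\|_{L^2(\partial D)}^2 .$$ -/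

import Mathlib

open MeasureTheory Filter Topology
open scoped ContDiff

noncomputable section

namespace RobinTransmission

/-- The space `ℝᵈ` with its Euclidean norm. -/
abbrev Space (d : ℕ) : Type := EuclideanSpace ℝ (Fin d)

/-- The space `ℂᵈ`, in which gradients of complex-valued functions take their values. -/
abbrev CVec (d : ℕ) : Type := EuclideanSpace ℂ (Fin d)

/-- The partial derivative `∂ φ / ∂ xᵢ` of a differentiable function on `ℝᵈ`. -/
def partialDeriv {d : ℕ} {F : Type*} [NormedAddCommGroup F] [NormedSpace ℝ F]
    (i : Fin d) (φ : Space d → F) (x : Space d) : F :=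
  fderiv ℝ φ x (EuclideanSpace.single i 1)

/-- The classical gradient of a complex-valued function on `ℝᵈ`. -/
def classicalGrad {d : ℕ} (φ : Space d → ℂ) (x : Space d) : CVec d :=
  WithLp.toLp 2 fun i => partialDeriv i φ x

/-- `φ ∈ C_c^∞(U)`, for real- or complex-valued functions. -/
structure IsTestFunction {d : ℕ} {F : Type*} [NormedAddCommGroup F] [NormedSpace ℝ F]
    (U : Set (Space d)) (φ : Space d → F) : Prop where
  smooth : ContDiff ℝ ∞ φ
  compact : HasCompactSupport φ
  support_subset : tsupport φ ⊆ U

/-! ### The Sobolev spaces `H¹(Ω)` and `H¹₀(Ω)` -/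

/-- `G` is the weak gradient of `u` on `Ω`:
`∫_Ω (∂ᵢ φ) u dx = - ∫_Ω φ Gᵢ dx` for all real `φ ∈ C_c^∞(Ω)` and all `i`. -/
def HasWeakGradient {d : ℕ} (Ω : Set (Space d)) (u : Space d → ℂ) (G : Space d → CVec d) : Prop :=
  ∀ φ : Space d → ℝ, IsTestFunction Ω φ → ∀ i : Fin d,
    ∫ x in Ω, partialDeriv i φ x • u x = - ∫ x in Ω, φ x • G x i

/-- The Hilbert space `L²(Ω; ℂ) × L²(Ω; ℂᵈ)` with norm `(‖u‖² + ‖G‖²)^{1/2}`. -/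
abbrev L2Pair {d : ℕ} (Ω : Set (Space d)) : Type :=
  WithLp 2 (Lp ℂ 2 (volume.restrict Ω) × Lp (CVec d) 2 (volume.restrict Ω))

lemma integrable_smul_of_bounded {d : ℕ} {Ω : Set (Space d)} {φ : Space d → ℝ}
    (hc : Continuous φ) (hs : HasCompactSupport φ) {u : Space d → ℂ}
    (hu : MemLp u 2 (volume.restrict Ω)) :
    Integrable (fun x => φ x • u x) (volume.restrict Ω) := by
  have h1 : MemLp φ 2 (volume.restrict Ω) := hc.memLp_of_hasCompactSupport hs
  exact hu.smul h1 |> memLp_one_iff_integrable.1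

lemma IsTestFunction.continuous_partialDeriv {d : ℕ} {Ω : Set (Space d)} {φ : Space d → ℝ}
    (h : IsTestFunction Ω φ) (i : Fin d) : Continuous (partialDeriv i φ) :=
  (h.smooth.continuous_fderiv (by simp)).clm_apply continuous_const

lemma IsTestFunction.hasCompactSupport_partialDeriv {d : ℕ} {Ω : Set (Space d)}
    {φ : Space d → ℝ} (h : IsTestFunction Ω φ) (i : Fin d) :
    HasCompactSupport (partialDeriv i φ) :=
  h.compact.fderiv_apply ℝ _

lemma memLp_coord {d : ℕ} {μ : Measure (Space d)} (G : Lp (CVec d) 2 μ) (i : Fin d) :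
    MemLp (fun x => G x i) 2 μ :=
  (Lp.memLp G).continuousLinearMap_comp (EuclideanSpace.proj (𝕜 := ℂ) i)

/-- The Sobolev space `H¹(Ω)` of complex-valued functions. An element is a pair consisting of a
function `u ∈ L²(Ω)` and its (unique) weak gradient `∇u ∈ L²(Ω)ᵈ`; norm and inner product are
`‖u‖² + ‖∇u‖²` and `(u, v) + (∇u, ∇v)`. -/
def H1 {d : ℕ} (Ω : Set (Space d)) : Submodule ℂ (L2Pair Ω) where
  carrier := {p | HasWeakGradient Ω p.fst p.snd}
  zero_mem' := by
    intro φ hφ i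
    have h1 : ((0 : L2Pair Ω).fst : Space d → ℂ) =ᵐ[volume.restrict Ω] 0 := Lp.coeFn_zero _ _ _
    have h2 : ((0 : L2Pair Ω).snd : Space d → CVec d) =ᵐ[volume.restrict Ω] 0 :=
      Lp.coeFn_zero _ _ _
    rw [integral_eq_zero_of_ae, integral_eq_zero_of_ae, neg_zero]
    · filter_upwards [h2] with x hx
      rw [hx]
      simp
    · filter_upwards [h1] with x hx
      rw [hx]
      simp
  add_mem' := by
    intro p q hp hq φ hφ i
    have h1 : ((p + q).fst : Space d → ℂ) =ᵐ[volume.restrict Ω] p.fst + q.fst :=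
      Lp.coeFn_add _ _
    have h2 : ((p + q).snd : Space d → CVec d) =ᵐ[volume.restrict Ω] p.snd + q.snd :=
      Lp.coeFn_add _ _
    have e1 : ∫ x in Ω, partialDeriv i φ x • (p + q).fst x
        = ∫ x in Ω, (partialDeriv i φ x • p.fst x + partialDeriv i φ x • q.fst x) := by
      refine integral_congr_ae ?_
      filter_upwards [h1] with x hx
      rw [hx]
      simp
    have e2 : ∫ x in Ω, φ x • (p + q).snd x i
        = ∫ x in Ω, (φ x • p.snd x i + φ x • q.snd x i) := by
      refine integral_congr_ae ?_
      filter_upwards [h2] with x hx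
      rw [hx]
      simp
    have c1 := hφ.continuous_partialDeriv i
    have c2 := hφ.hasCompactSupport_partialDeriv i
    have c3 := hφ.smooth.continuous
    rw [e1, e2, integral_add (integrable_smul_of_bounded c1 c2 (Lp.memLp _))
      (integrable_smul_of_bounded c1 c2 (Lp.memLp _)),
      integral_add (integrable_smul_of_bounded c3 hφ.compact (memLp_coord _ i))
      (integrable_smul_of_bounded c3 hφ.compact (memLp_coord _ i)), hp φ hφ i, hq φ hφ i]
    ring
  smul_mem' := by
    intro c p hp φ hφ i
    have h1 : ((c • p).fst : Space d → ℂ) =ᵐ[volume.restrict Ω] c • (p.fst : Space d → ℂ) :=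
      Lp.coeFn_smul _ _
    have h2 : ((c • p).snd : Space d → CVec d) =ᵐ[volume.restrict Ω]
        c • (p.snd : Space d → CVec d) :=
      Lp.coeFn_smul _ _
    have e1 : ∫ x in Ω, partialDeriv i φ x • (c • p).fst x
        = ∫ x in Ω, c * (partialDeriv i φ x • p.fst x) := by
      refine integral_congr_ae ?_
      filter_upwards [h1] with x hx
      rw [hx]
      simp
      ring
    have e2 : ∫ x in Ω, φ x • (c • p).snd x i = ∫ x in Ω, c * (φ x • p.snd x i) := by
      refine integral_congr_ae ?_
      filter_upwards [h2] with x hx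
      rw [hx]
      simp
      ring
    rw [e1, e2, integral_const_mul, integral_const_mul, hp φ hφ i]
    ring

/-- The function underlying an element of `H¹(Ω)` (determined a.e. on `Ω`). -/
def H1fn {d : ℕ} {Ω : Set (Space d)} (w : H1 Ω) : Space d → ℂ := w.1.fst

/-- The weak gradient `∇w` of an element of `H¹(Ω)` (determined a.e. on `Ω`). -/
def H1grad {d : ℕ} {Ω : Set (Space d)} (w : H1 Ω) : Space d → CVec d := w.1.snd

/-- The elements of `H¹(Ω)` that are given by a function in `C_c^∞(Ω)`. -/
def testClasses {d : ℕ} (Ω : Set (Space d)) : Set (H1 Ω) :=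
  {w | ∃ φ : Space d → ℂ, IsTestFunction Ω φ ∧ H1fn w =ᵐ[volume.restrict Ω] φ}

/-- `H¹₀(Ω)`, the closure of `C_c^∞(Ω)` in `H¹(Ω)`. (The set `testClasses Ω` is already a linear
subspace, so taking its span adds nothing.) -/
def H10 {d : ℕ} (Ω : Set (Space d)) : Submodule ℂ (H1 Ω) :=
  (Submodule.span ℂ (testClasses Ω)).topologicalClosure

/-! ### The interface `∂D` -/

/-- The open set `D` has a boundary of class `C²`: near each boundary point, and in suitable
Cartesian coordinates `(y', y_d)`, the set `D` is the region above the graph of a `C²` function. -/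
def HasC2Boundary {d : ℕ} (D : Set (Space d)) : Prop :=
  ∀ x ∈ frontier D, ∃ r > 0, ∃ e : Space d ≃ᵃⁱ[ℝ] WithLp 2 (Space (d - 1) × ℝ),
    ∃ g : Space (d - 1) → ℝ, ContDiff ℝ 2 g ∧
      ∀ y ∈ Metric.ball x r, y ∈ D ↔ g (e y).fst < (e y).snd

/-- The surface measure `ds` on `∂D`: the `(d-1)`-dimensional Hausdorff measure, normalised to
agree with Lebesgue measure on `(d-1)`-dimensional planes. -/
def surfaceMeasure {d : ℕ} (D : Set (Space d)) : Measure (Space d) :=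
  (Measure.euclideanHausdorffMeasure (d - 1)).restrict (frontier D)

/-- The Hilbert space `L²(∂D)` of complex-valued functions. -/
abbrev L2Boundary {d : ℕ} (D : Set (Space d)) : Type := Lp ℂ 2 (surfaceMeasure D)

/-- `τ ∈ L²(∂D)` is the trace on `∂D` of `w ∈ H¹(Ω)`, where `closure D ⊆ Ω`: there are functions
`φₙ ∈ C^∞(Ω) ∩ H¹(Ω)` which converge to `w` in `H¹(Ω)` and whose restrictions to `∂D` converge to
`τ` in `L²(∂D)`. -/
def IsTrace {d : ℕ} {Ω : Set (Space d)} (D : Set (Space d)) (w : H1 Ω) (τ : L2Boundary D) : Prop :=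
  ∃ (u : ℕ → H1 Ω) (φ : ℕ → Space d → ℂ),
    (∀ n, ContDiffOn ℝ ∞ (φ n) Ω ∧ H1fn (u n) =ᵐ[volume.restrict Ω] φ n) ∧
    Tendsto u atTop (𝓝 w) ∧
    Tendsto (fun n => eLpNorm (fun x => φ n x - τ x) 2 (surfaceMeasure D)) atTop (𝓝 0)

/-! ### The transmission problem -/

/-- `- Δ w = 0` in the open set `U ⊆ Ω`, in the weak sense. -/
def WeaklyHarmonicOn {d : ℕ} {Ω : Set (Space d)} (w : H1 Ω) (U : Set (Space d)) : Prop :=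
  ∀ φ : Space d → ℂ, IsTestFunction U φ →
    ∫ x in U, inner ℂ (classicalGrad φ x) (H1grad w x) = 0

/-- The interior normal derivative `∂_ν w⁻` on `∂D` (`ν` outward to `D`) of a function `w` that is
harmonic in `D`, as an element of the dual of the trace space: by Green's identity in `D`,
`⟨∂_ν w⁻, φ⟩ = ∫_{∂D} ∂_ν w⁻ φ̄ ds = ∫_D ∇w · ∇φ̄ dx`. -/
def interiorNormalDeriv {d : ℕ} {Ω : Set (Space d)} (D : Set (Space d)) (w φ : H1 Ω) : ℂ :=
  ∫ x in D, inner ℂ (H1grad φ x) (H1grad w x)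

/-- The exterior normal derivative `∂_ν w⁺` on `∂D` (`ν` outward to `D`) of a function `w` that is
harmonic in `Ω \ closure D`, as an element of the dual of the trace space: by Green's identity in
`Ω \ closure D`, for `φ ∈ H¹₀(Ω)`,
`⟨∂_ν w⁺, φ⟩ = ∫_{∂D} ∂_ν w⁺ φ̄ ds = - ∫_{Ω \ closure D} ∇w · ∇φ̄ dx`. -/
def exteriorNormalDeriv {d : ℕ} {Ω : Set (Space d)} (D : Set (Space d)) (w φ : H1 Ω) : ℂ :=
  - ∫ x in Ω \ closure D, inner ℂ (H1grad φ x) (H1grad w x)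

/-- `w ∈ H¹₀(Ω)` solves `- Δ w = 0` in `Ω \ ∂D`, `⟦∂_ν w⟧ = ∂_ν w⁺ - ∂_ν w⁻ = γ h` on `∂D`. The
jump condition is an equality of functionals on the traces of functions `φ ∈ H¹₀(Ω)`. -/
structure SolvesTransmission {d : ℕ} {Ω : Set (Space d)} (D : Set (Space d)) (γ : Space d → ℝ)
    (h : L2Boundary D) (w : H1 Ω) : Prop where
  mem_H10 : w ∈ H10 Ω
  harmonic : WeaklyHarmonicOn w (Ω \ frontier D)
  jump : ∀ φ ∈ H10 Ω, ∀ τ : L2Boundary D, IsTrace D φ τ →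
    exteriorNormalDeriv D w φ - interiorNormalDeriv D w φ
      = ∫ x, (γ x : ℂ) * h x * (starRingEnd ℂ) (τ x) ∂(surfaceMeasure D)

end RobinTransmission

end

open RobinTransmission

/-!
The jump condition and the differential equation together say that `w ∈ H¹₀(Ω)` satisfies
`∫_Ω ∇w · ∇φ̄ dx = - ∫_{∂D} γ h φ̄ ds` for all `φ ∈ H¹₀(Ω)` (`solvesTransmission_iff`): the boundary
`∂D` is a Lebesgue null set, so `Ω` is the union of its interior and exterior parts up to a null
set, and test functions supported away from `∂D` have trace zero. By the Poincaré inequality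
(`exists_poincare`) the left-hand side is a coercive form on `H¹₀(Ω)`, and by the boundedness of the
trace the right-hand side is a bounded functional, so the solution exists, is unique, and depends
linearly and continuously on `h` (`exists_solutionOperator`). Testing the equation with `φ = w`
gives `(γ w|_{∂D}, h) = - ‖∇w‖²`, and with it the formula for `(T h, h)` (`energy_identity`).

The analytic core is the trace inequality for functions that are smooth in `Ω`
(`trace_inequality`). Near a boundary point, `∂D` is the graph of a function `g`, with vertical unit
vector `v`. The fundamental theorem of calculus compares `f (p)` with `f (p + t v)` for `p ∈ ∂D`
and `t ∈ [0, δ]`; the estimate is averaged over `t` and integrated over `p`. Two facts bound the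
resulting integral by an integral over `Ω`: the chart `(y', t) ↦ (y', g y' + t)` preserves Lebesgue
measure (`measurePreserving_graphFlow`), and the Hausdorff measure on a Lipschitz graph is at most a
multiple of the Lebesgue measure on its base (`hausdorff_restrict_graph_le`). Compactness of `∂D`
makes finitely many patches suffice. The inequality then yields uniqueness of traces, and their
existence on `H¹₀(Ω)` by approximation with test functions. The Poincaré inequality comes from the
same one-dimensional estimate, along segments that leave `Ω`.
-/

noncomputable section

namespace RobinTransmission

open scoped ENNReal NNReal

/-! ### Graphs and the vertical flow -/

lemma euclideanHausdorffMeasure_image_le {X Y : Type*} [EMetricSpace X] [EMetricSpace Y]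
    [MeasurableSpace X] [BorelSpace X] [MeasurableSpace Y] [BorelSpace Y] {K : ℝ≥0} {f : X → Y}
    {s : Set X} (hf : LipschitzOnWith K f s) (m : ℕ) :
    Measure.euclideanHausdorffMeasure m (f '' s)
      ≤ (K : ℝ≥0∞) ^ m * Measure.euclideanHausdorffMeasure m s := by
  have h := hf.hausdorffMeasure_image_le (d := m) (Nat.cast_nonneg m)
  rw [ENNReal.rpow_natCast] at h
  simp only [Measure.euclideanHausdorffMeasure_def, Measure.smul_apply, ENNReal.smul_def,
    smul_eq_mul]
  rw [mul_left_comm]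
  gcongr

lemma measurePreserving_affineIsometryEquiv {V W : Type*} [NormedAddCommGroup V]
    [InnerProductSpace ℝ V] [FiniteDimensional ℝ V] [MeasurableSpace V] [BorelSpace V]
    [NormedAddCommGroup W] [InnerProductSpace ℝ W] [FiniteDimensional ℝ W] [MeasurableSpace W]
    [BorelSpace W] (e : V ≃ᵃⁱ[ℝ] W) : MeasurePreserving e := by
  have h : (e : V → W) = (fun y => y + e 0) ∘ e.linearIsometryEquiv := by
    ext x
    have := e.map_vadd 0 x
    simpa using this
  rw [h]
  exact (measurePreserving_add_right volume (e 0)).comp e.linearIsometryEquiv.measurePreserving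

/-- The chart `(y', t) ↦ (y', g y' + t)`, read in the Cartesian coordinates `e`, of the region
around the graph of `g`. -/
def graphFlow {d m : ℕ} (e : Space d ≃ᵃⁱ[ℝ] WithLp 2 (Space m × ℝ)) (g : Space m → ℝ)
    (q : Space m × ℝ) : Space d :=
  e.symm (WithLp.toLp 2 (q.1, g q.1 + q.2))

/-- The unit vector of `ℝᵈ` pointing upwards in the Cartesian coordinates `e`. -/
def vertical {d m : ℕ} (e : Space d ≃ᵃⁱ[ℝ] WithLp 2 (Space m × ℝ)) : Space d :=
  e.linearIsometryEquiv.symm (WithLp.toLp 2 (0, 1))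

lemma norm_vertical {d m : ℕ} (e : Space d ≃ᵃⁱ[ℝ] WithLp 2 (Space m × ℝ)) :
    ‖vertical e‖ = 1 := by
  rw [vertical, LinearIsometryEquiv.norm_map, WithLp.prod_norm_eq_of_L2]
  simp

lemma graphFlow_add {d m : ℕ} (e : Space d ≃ᵃⁱ[ℝ] WithLp 2 (Space m × ℝ)) (g : Space m → ℝ)
    (y : Space m) (t : ℝ) : graphFlow e g (y, t) = graphFlow e g (y, 0) + t • vertical e := by
  have h := e.symm.map_vadd (WithLp.toLp 2 (y, g y)) (WithLp.toLp 2 (0, t))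
  have h2 : t • vertical e = e.symm.linearIsometryEquiv (WithLp.toLp 2 (0, t)) := by
    have : (WithLp.toLp 2 ((0 : Space m), t)) = t • WithLp.toLp 2 ((0 : Space m), (1 : ℝ)) := by
      rw [← WithLp.toLp_smul, Prod.smul_mk, smul_zero, smul_eq_mul, mul_one]
    rw [this, map_smul]
    rfl
  rw [vadd_eq_add, vadd_eq_add, ← WithLp.toLp_add, Prod.mk_add_mk, zero_add] at h
  rw [h2]
  simp only [graphFlow, add_zero]
  rw [add_comm (g y) t, h, add_comm]

lemma measurePreserving_graphFlow {d m : ℕ} (e : Space d ≃ᵃⁱ[ℝ] WithLp 2 (Space m × ℝ))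
    {g : Space m → ℝ} (hg : Continuous g) :
    MeasurePreserving (graphFlow e g) (volume.prod volume) volume := by
  have h1 : MeasurePreserving (fun q : Space m × ℝ => (q.1, g q.1 + q.2))
      (volume.prod volume) (volume.prod volume) := by
    refine (MeasurePreserving.id volume).skew_product (g := fun y t => g y + t) ?_ ?_
    · exact (by fun_prop : Continuous (Function.uncurry fun y t => g y + t)).measurable
    · exact Eventually.of_forall fun y => (measurePreserving_add_left volume (g y)).map_eq
  exact (measurePreserving_affineIsometryEquiv e.symm).comp
    ((WithLp.volume_preserving_toLp (Space m) ℝ).comp h1)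

lemma graphFlow_fst_of_mem_graph {d m : ℕ} {e : Space d ≃ᵃⁱ[ℝ] WithLp 2 (Space m × ℝ)}
    {g : Space m → ℝ} {p : Space d} (hp : (e p).snd = g (e p).fst) :
    graphFlow e g ((e p).fst, 0) = p := by
  rw [graphFlow, add_zero, ← hp]
  exact e.symm_apply_apply p

lemma volume_graph_eq_zero {d m : ℕ} (e : Space d ≃ᵃⁱ[ℝ] WithLp 2 (Space m × ℝ))
    {g : Space m → ℝ} (hg : Continuous g) :
    volume {p : Space d | (e p).snd = g (e p).fst} = 0 := by
  have hm : MeasurableSet {p : Space d | (e p).snd = g (e p).fst} := by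
    have he : Continuous e := e.continuous
    exact (isClosed_eq (by fun_prop) (by fun_prop)).measurableSet
  rw [← (measurePreserving_graphFlow e hg).measure_preimage hm.nullMeasurableSet]
  have : graphFlow e g ⁻¹' {p : Space d | (e p).snd = g (e p).fst}
      = Set.univ ×ˢ ({0} : Set ℝ) := by
    ext ⟨y, t⟩
    simp [graphFlow]
  rw [this, Measure.prod_prod]
  simp

lemma lipschitzOnWith_graphFlow {d m : ℕ} (e : Space d ≃ᵃⁱ[ℝ] WithLp 2 (Space m × ℝ))
    {g : Space m → ℝ} {K : ℝ≥0} {A : Set (Space m)} (hg : LipschitzOnWith K g A) :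
    LipschitzOnWith (1 + K) (fun y => graphFlow e g (y, 0)) A := by
  refine LipschitzOnWith.of_dist_le_mul fun y hy z hz => ?_
  have h := hg.dist_le_mul y hy z hz
  simp only [graphFlow, add_zero, AffineIsometryEquiv.dist_map, NNReal.coe_add, NNReal.coe_one]
  rw [WithLp.prod_dist_eq_of_L2]
  refine Real.sqrt_le_iff.2 ⟨by positivity, ?_⟩
  have h0 := dist_nonneg (x := y) (y := z)
  have h1 := dist_nonneg (x := g y) (y := g z)
  have hK : (0 : ℝ) ≤ K := K.2
  have : dist (g y) (g z) ^ 2 ≤ (K * dist y z) ^ 2 := by gcongr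
  change dist y z ^ 2 + dist (g y) (g z) ^ 2 ≤ _
  nlinarith [mul_nonneg hK (sq_nonneg (dist y z))]

/-- The Hausdorff measure on a graph with bounded slopes is dominated by a multiple of the Lebesgue
measure on the base of the graph: the chart is Lipschitz. Only this inequality, and no area
formula, is needed for the trace estimate. -/
lemma hausdorff_restrict_graph_le {d m : ℕ} (e : Space d ≃ᵃⁱ[ℝ] WithLp 2 (Space m × ℝ))
    {g : Space m → ℝ} (hg : Continuous g) {S : Set (Space d)}
    (hS : ∀ p ∈ S, (e p).snd = g (e p).fst) {K : ℝ≥0}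
    (hK : LipschitzOnWith K g ((fun p => (e p).fst) '' S)) :
    (Measure.euclideanHausdorffMeasure m).restrict S
      ≤ ((1 + K : ℝ≥0) : ℝ≥0∞) ^ m • (volume.map fun y => graphFlow e g (y, 0)) := by
  have hc : Continuous fun y => graphFlow e g (y, 0) := by
    have he : Continuous e.symm := e.symm.continuous
    unfold graphFlow
    fun_prop
  refine Measure.le_iff.2 fun B hB => ?_
  rw [Measure.restrict_apply hB, Measure.smul_apply, Measure.map_apply hc.measurable hB,
    smul_eq_mul]
  set P : Space d → Space m := fun p => (e p).fst
  have h1 : B ∩ S = (fun y => graphFlow e g (y, 0)) '' (P '' (B ∩ S)) := by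
    rw [Set.image_image]
    ext p
    constructor
    · intro hp
      exact ⟨p, hp, graphFlow_fst_of_mem_graph (hS p hp.2)⟩
    · rintro ⟨q, hq, rfl⟩
      simp only [P]
      rwa [graphFlow_fst_of_mem_graph (hS q hq.2)]
  have h2 : P '' (B ∩ S) ⊆ (fun y => graphFlow e g (y, 0)) ⁻¹' B := by
    rintro _ ⟨q, hq, rfl⟩
    simp only [P, Set.mem_preimage]
    rw [graphFlow_fst_of_mem_graph (hS q hq.2)]
    exact hq.1
  calc Measure.euclideanHausdorffMeasure m (B ∩ S)
      = Measure.euclideanHausdorffMeasure m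
          ((fun y => graphFlow e g (y, 0)) '' (P '' (B ∩ S))) := by rw [← h1]
    _ ≤ ((1 + K : ℝ≥0) : ℝ≥0∞) ^ m * Measure.euclideanHausdorffMeasure m (P '' (B ∩ S)) :=
        euclideanHausdorffMeasure_image_le
          ((lipschitzOnWith_graphFlow e hK).mono (Set.image_mono Set.inter_subset_right)) m
    _ ≤ _ := by
        rw [EuclideanSpace.euclideanHausdorffMeasure_eq_volume]
        gcongr

lemma lintegral_graph_flow_le {d m : ℕ} (e : Space d ≃ᵃⁱ[ℝ] WithLp 2 (Space m × ℝ))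
    {g : Space m → ℝ} (hg : Continuous g) {S : Set (Space d)}
    (hS : ∀ p ∈ S, (e p).snd = g (e p).fst) {K : ℝ≥0}
    (hK : LipschitzOnWith K g ((fun p => (e p).fst) '' S)) (I : Set ℝ)
    {F : Space d → ℝ≥0∞} (hF : Measurable F) :
    ∫⁻ p in S, (∫⁻ t in I, F (p + t • vertical e)) ∂(Measure.euclideanHausdorffMeasure m)
      ≤ ((1 + K : ℝ≥0) : ℝ≥0∞) ^ m * ∫⁻ x, F x := by
  have hc : Continuous fun y => graphFlow e g (y, 0) := by
    have he : Continuous e.symm := e.symm.continuous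
    unfold graphFlow
    fun_prop
  have hm : Measurable fun p : Space d => ∫⁻ t in I, F (p + t • vertical e) := by
    refine Measurable.lintegral_prod_right' (f := fun q : Space d × ℝ => F (q.1 + q.2 • vertical e))
      (hF.comp ?_)
    exact (by fun_prop : Continuous fun q : Space d × ℝ => q.1 + q.2 • vertical e).measurable
  calc _ ≤ ∫⁻ p, (∫⁻ t in I, F (p + t • vertical e))
        ∂(((1 + K : ℝ≥0) : ℝ≥0∞) ^ m • (volume.map fun y => graphFlow e g (y, 0))) :=
        lintegral_mono' (hausdorff_restrict_graph_le e hg hS hK) le_rfl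
    _ = ((1 + K : ℝ≥0) : ℝ≥0∞) ^ m
          * ∫⁻ y, ∫⁻ t in I, F (graphFlow e g (y, 0) + t • vertical e) := by
        rw [lintegral_smul_measure, lintegral_map hm hc.measurable, smul_eq_mul]
    _ ≤ ((1 + K : ℝ≥0) : ℝ≥0∞) ^ m * ∫⁻ y, ∫⁻ t, F (graphFlow e g (y, t)) := by
        refine mul_le_mul_right (lintegral_mono fun y => ?_) _
        refine (setLIntegral_le_lintegral _ _).trans_eq (lintegral_congr fun t => ?_)
        rw [graphFlow_add e g y t]
    _ = ((1 + K : ℝ≥0) : ℝ≥0∞) ^ m * ∫⁻ x, F x := by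
        have h := measurePreserving_graphFlow e hg
        rw [← h.lintegral_comp hF, lintegral_prod]
        exact (hF.comp h.measurable).aemeasurable

/-- Near a boundary point of a set with `C²` boundary, the boundary is a Lebesgue null set, and
integrating over the segments `p + [0, δ] v`, for `p` on the boundary and a fixed transversal unit
vector `v`, is controlled by integrating over `ℝᵈ`. The segments remain in a prescribed open set. -/
lemma exists_boundary_patch {d : ℕ} {Ω D : Set (Space d)} (hΩ : IsOpen Ω) (hD : IsOpen D)
    (hD2 : HasC2Boundary D) {x : Space d} (hx : x ∈ frontier D) (hxΩ : x ∈ Ω) :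
    ∃ ρ > 0, ∃ δ > (0 : ℝ), ∃ v : Space d, ‖v‖ = 1 ∧ ∃ C : ℝ≥0∞, C ≠ ⊤ ∧
      volume (frontier D ∩ Metric.ball x ρ) = 0 ∧
      (∀ p ∈ Metric.ball x ρ, ∀ t ∈ Set.Icc 0 δ, p + t • v ∈ Ω) ∧
      ∀ F : Space d → ℝ≥0∞, Measurable F →
        ∫⁻ p in frontier D ∩ Metric.ball x ρ, (∫⁻ t in Set.Icc 0 δ, F (p + t • v))
          ∂(Measure.euclideanHausdorffMeasure (d - 1)) ≤ C * ∫⁻ y, F y := by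
  obtain ⟨r, hr, e, g, hg2, hgD⟩ := hD2 x hx
  have hg : Continuous g := hg2.continuous
  have he : Continuous e := e.continuous
  obtain ⟨r', hr', hrΩ⟩ := Metric.isOpen_iff.1 hΩ x hxΩ
  obtain ⟨K, A, hA, hKA⟩ :=
    ((hg2.contDiffAt (x := (e x).fst)).of_le (by norm_num)).exists_lipschitzOnWith
  obtain ⟨s, hs, hsA⟩ : ∃ s > 0, ∀ p ∈ Metric.ball x s, (e p).fst ∈ A := by
    have : ContinuousAt (fun p => (e p).fst) x := by fun_prop
    exact Metric.mem_nhds_iff.1 (this hA)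
  -- Boundary points in the ball lie on the graph: one strictly below it would have a whole
  -- neighbourhood outside of `D`.
  have hgraph : ∀ p ∈ frontier D ∩ Metric.ball x r, (e p).snd = g (e p).fst := by
    rintro p ⟨hpD, hpr⟩
    rw [hD.frontier_eq] at hpD
    refine le_antisymm (not_lt.1 fun h => hpD.2 ((hgD p hpr).2 h)) (not_lt.1 fun h => ?_)
    have hU : IsOpen (Metric.ball x r ∩ {q | (e q).snd < g (e q).fst}) :=
      Metric.isOpen_ball.inter (isOpen_lt (by fun_prop) (by fun_prop))
    obtain ⟨q, ⟨hqr, hq⟩, hqD⟩ := mem_closure_iff.1 hpD.1 _ hU ⟨hpr, h⟩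
    exact lt_asymm hq ((hgD q hqr).1 hqD)
  have hρ : 0 < min r (min s (r' / 2)) := by positivity
  have hS : ∀ p ∈ frontier D ∩ Metric.ball x (min r (min s (r' / 2))),
      (e p).snd = g (e p).fst := fun p hp =>
    hgraph p ⟨hp.1, Metric.ball_subset_ball (min_le_left _ _) hp.2⟩
  refine ⟨_, hρ, r' / 4, by positivity, vertical e, norm_vertical e,
    ((1 + K : ℝ≥0) : ℝ≥0∞) ^ (d - 1), ENNReal.pow_ne_top ENNReal.coe_ne_top, ?_, ?_, ?_⟩
  · exact measure_mono_null (fun p hp => hS p hp) (volume_graph_eq_zero e hg)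
  · intro p hp t ht
    apply hrΩ
    have h1 : dist p x < r' / 2 :=
      (Metric.mem_ball.1 hp).trans_le ((min_le_right _ _).trans (min_le_right _ _))
    have h2 : dist (p + t • vertical e) p ≤ r' / 4 := by
      rw [dist_eq_norm, add_sub_cancel_left, norm_smul, norm_vertical, mul_one, Real.norm_eq_abs,
        abs_of_nonneg ht.1]
      exact ht.2
    have := dist_triangle (p + t • vertical e) p x
    rw [Metric.mem_ball]
    linarith
  · intro F hF
    refine lintegral_graph_flow_le e hg hS (hKA.mono ?_) _ hF
    rintro _ ⟨p, hp, rfl⟩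
    exact hsA p (Metric.ball_subset_ball ((min_le_right _ _).trans (min_le_left _ _)) hp.2)

/-- The boundary of a bounded open set of class `C²` is a Lebesgue null set. -/
lemma volume_frontier_eq_zero {d : ℕ} {D : Set (Space d)} (hD : IsOpen D)
    (hDb : Bornology.IsBounded D) (hD2 : HasC2Boundary D) : volume (frontier D) = 0 := by
  have hcpt : IsCompact (frontier D) :=
    hDb.isCompact_closure.of_isClosed_subset isClosed_frontier frontier_subset_closure
  refine hcpt.induction_on (p := fun s => volume s = 0) measure_empty
    (fun s t hst ht => measure_mono_null hst ht) (fun s t hs ht => measure_union_null hs ht) ?_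
  intro x hx
  obtain ⟨ρ, hρ, -, -, -, -, -, -, h0, -⟩ :=
    exists_boundary_patch isOpen_univ hD hD2 hx (Set.mem_univ x)
  exact ⟨_, inter_mem_nhdsWithin _ (Metric.ball_mem_nhds x hρ), h0⟩

/-! ### Estimates along segments -/

lemma enorm_add_sq_le {E : Type*} [NormedAddCommGroup E] (a b : E) :
    ‖a + b‖ₑ ^ 2 ≤ 2 * ‖a‖ₑ ^ 2 + 2 * ‖b‖ₑ ^ 2 := by
  calc ‖a + b‖ₑ ^ 2 ≤ (‖a‖ₑ + ‖b‖ₑ) ^ 2 := by gcongr; exact enorm_add_le a b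
    _ ≤ 2 * ‖a‖ₑ ^ 2 + 2 * ‖b‖ₑ ^ 2 := by
      simp only [enorm_eq_nnnorm]
      exact_mod_cast (add_sq_le (a := ‖a‖₊) (b := ‖b‖₊)).trans_eq (mul_add _ _ _)

lemma sq_lintegral_le {α : Type*} [MeasurableSpace α] {μ : Measure α} {f : α → ℝ≥0∞}
    (hf : AEMeasurable f μ) : (∫⁻ a, f a ∂μ) ^ 2 ≤ μ Set.univ * ∫⁻ a, f a ^ 2 ∂μ := by
  have h := ENNReal.lintegral_mul_le_Lp_mul_Lq μ Real.HolderConjugate.two_two hf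
    (aemeasurable_const (b := (1 : ℝ≥0∞)))
  simp only [Pi.mul_apply, mul_one, ENNReal.one_rpow, lintegral_const, one_mul] at h
  calc _ ≤ ((∫⁻ a, f a ^ (2 : ℝ) ∂μ) ^ (1 / 2 : ℝ) * μ Set.univ ^ (1 / 2 : ℝ)) ^ 2 := by gcongr
    _ = _ := by
      rw [mul_pow, ← ENNReal.rpow_natCast, ← ENNReal.rpow_natCast, ← ENNReal.rpow_mul,
        ← ENNReal.rpow_mul, mul_comm]
      norm_num

lemma norm_fderiv_apply_le {d : ℕ} (f : Space d → ℂ) (x v : Space d) :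
    ‖fderiv ℝ f x v‖ ≤ ‖v‖ * ‖classicalGrad f x‖ := by
  have hv : v = ∑ i, v i • EuclideanSpace.single i (1 : ℝ) := by
    ext j
    simp [Pi.single_apply]
  have h1 : fderiv ℝ f x v
      = inner ℂ (WithLp.toLp 2 fun i => ((v i : ℝ) : ℂ) : CVec d) (classicalGrad f x) := by
    conv_lhs => rw [hv, map_sum]
    rw [PiLp.inner_apply]
    refine Finset.sum_congr rfl fun i _ => ?_
    rw [map_smul]
    simp [classicalGrad, partialDeriv, mul_comm]
  rw [h1]
  refine (norm_inner_le_norm _ _).trans_eq ?_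
  congr 1
  simp [EuclideanSpace.norm_eq]

/-- The fundamental theorem of calculus on the segment from `p` to `p + t v`, squared. -/
lemma enorm_sq_le_segment {d : ℕ} {U : Set (Space d)} (hU : IsOpen U) {f : Space d → ℂ}
    (hf : ContDiffOn ℝ ∞ f U) {p v : Space d} (hv : ‖v‖ = 1) {δ t : ℝ} (ht : t ∈ Set.Icc 0 δ)
    (hseg : ∀ s ∈ Set.Icc 0 δ, p + s • v ∈ U) :
    ‖f p‖ₑ ^ 2 ≤ 2 * ‖f (p + t • v)‖ₑ ^ 2
      + 2 * (ENNReal.ofReal δ * ∫⁻ s in Set.Icc 0 δ, ‖classicalGrad f (p + s • v)‖ₑ ^ 2) := by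
  have hsub : Set.Icc 0 t ⊆ Set.Icc 0 δ := Set.Icc_subset_Icc_right ht.2
  have hcf : ContinuousOn (fderiv ℝ f) U := hf.continuousOn_fderiv_of_isOpen hU (by simp)
  have hline : ContinuousOn (fun s : ℝ => p + s • v) (Set.Icc 0 δ) := by fun_prop
  have hcd : ContinuousOn (fun s : ℝ => fderiv ℝ f (p + s • v) v) (Set.Icc 0 δ) :=
    (hcf.comp hline hseg).clm_apply continuousOn_const
  have hderiv : ∀ s ∈ Set.Icc 0 t,
      HasDerivAt (fun s : ℝ => f (p + s • v)) (fderiv ℝ f (p + s • v) v) s := by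
    intro s hs
    have h1 : DifferentiableAt ℝ f (p + s • v) :=
      (hf.contDiffAt (hU.mem_nhds (hseg s (hsub hs)))).differentiableAt (by simp)
    have h2 : HasDerivAt (fun s : ℝ => p + s • v) v s := by
      simpa using ((hasDerivAt_id s).smul_const v).const_add p
    exact h1.hasFDerivAt.comp_hasDerivAt s h2
  have hint : ∫ s in (0 : ℝ)..t, fderiv ℝ f (p + s • v) v = f (p + t • v) - f p := by
    rw [intervalIntegral.integral_eq_sub_of_hasDerivAt (by rwa [Set.uIcc_of_le ht.1])
      (hcd.mono (by rwa [Set.uIcc_of_le ht.1])).intervalIntegrable]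
    simp
  have hFTC : ‖f p - f (p + t • v)‖ₑ ^ 2
      ≤ ENNReal.ofReal δ * ∫⁻ s in Set.Icc 0 δ, ‖classicalGrad f (p + s • v)‖ₑ ^ 2 := by
    calc ‖f p - f (p + t • v)‖ₑ ^ 2
        = ‖∫ s in Set.Ioc 0 t, fderiv ℝ f (p + s • v) v‖ₑ ^ 2 := by
          rw [← intervalIntegral.integral_of_le ht.1, hint, ← enorm_neg, neg_sub]
      _ ≤ (∫⁻ s in Set.Icc 0 δ, ‖fderiv ℝ f (p + s • v) v‖ₑ) ^ 2 := by
          gcongr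
          refine (enorm_integral_le_lintegral_enorm _).trans ?_
          exact lintegral_mono_set (Set.Ioc_subset_Icc_self.trans hsub)
      _ ≤ volume.restrict (Set.Icc 0 δ) Set.univ
            * ∫⁻ s in Set.Icc 0 δ, ‖fderiv ℝ f (p + s • v) v‖ₑ ^ 2 :=
          sq_lintegral_le (hcd.aestronglyMeasurable measurableSet_Icc).enorm
      _ ≤ _ := by
          rw [Measure.restrict_apply_univ, Real.volume_Icc, sub_zero]
          gcongr with s
          rw [enorm_le_iff_norm_le]
          simpa [hv] using norm_fderiv_apply_le f (p + s • v) v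
  calc ‖f p‖ₑ ^ 2 = ‖f (p + t • v) + (f p - f (p + t • v))‖ₑ ^ 2 := by congr 2; ring
    _ ≤ _ := enorm_add_sq_le _ _
    _ ≤ _ := by gcongr

lemma continuousOn_classicalGrad {d : ℕ} {U : Set (Space d)} (hU : IsOpen U) {f : Space d → ℂ}
    (hf : ContDiffOn ℝ ∞ f U) : ContinuousOn (classicalGrad f) U := by
  have hcf : ContinuousOn (fderiv ℝ f) U := hf.continuousOn_fderiv_of_isOpen hU (by simp)
  refine (PiLp.continuous_toLp 2 _).comp_continuousOn (continuousOn_pi.2 fun i => ?_)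
  exact hcf.clm_apply continuousOn_const

lemma measurable_indicator_enorm_sq {d : ℕ} {E : Type*} [NormedAddCommGroup E]
    {U : Set (Space d)} (hU : IsOpen U) {f : Space d → E} (hf : ContinuousOn f U) :
    Measurable (U.indicator fun x => ‖f x‖ₑ ^ 2) := by
  classical
  rw [← Set.piecewise_eq_indicator]
  refine ContinuousOn.measurable_piecewise ?_ continuousOn_const hU.measurableSet
  exact (ENNReal.continuous_pow 2).comp_continuousOn (continuous_enorm.comp_continuousOn hf)

/-! ### The trace inequality -/

/-- The trace inequality `‖f‖²_{L²(∂D)} ≤ C (‖f‖²_{L²(Ω)} + ‖∇f‖²_{L²(Ω)})`. Near a boundary point,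
the value of `f` at `p ∈ ∂D` is compared with its values at the points `p + t v`, the estimate is
averaged over `t ∈ [0, δ]` and integrated over `p`. -/
lemma trace_inequality {d : ℕ} {Ω D : Set (Space d)} (hΩ : IsOpen Ω)
    (hΩb : Bornology.IsBounded Ω) (hD : IsOpen D) (hDΩ : closure D ⊆ Ω) (hD2 : HasC2Boundary D) :
    ∃ C : ℝ≥0∞, C ≠ ⊤ ∧ ∀ f : Space d → ℂ, ContDiffOn ℝ ∞ f Ω →
      ∫⁻ x, ‖f x‖ₑ ^ 2 ∂(surfaceMeasure D)
        ≤ C * ((∫⁻ x in Ω, ‖f x‖ₑ ^ 2) + ∫⁻ x in Ω, ‖classicalGrad f x‖ₑ ^ 2) := by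
  have hcpt : IsCompact (frontier D) :=
    (hΩb.subset (subset_closure.trans hDΩ)).isCompact_closure.of_isClosed_subset
      isClosed_frontier frontier_subset_closure
  have key : ∃ C : ℝ≥0∞, C ≠ ⊤ ∧ ∀ f : Space d → ℂ, ContDiffOn ℝ ∞ f Ω →
      ∫⁻ x in frontier D, ‖f x‖ₑ ^ 2 ∂(surfaceMeasure D)
        ≤ C * ((∫⁻ x in Ω, ‖f x‖ₑ ^ 2) + ∫⁻ x in Ω, ‖classicalGrad f x‖ₑ ^ 2) := by
    refine hcpt.induction_on (p := fun s => ∃ C : ℝ≥0∞, C ≠ ⊤ ∧ ∀ f : Space d → ℂ,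
      ContDiffOn ℝ ∞ f Ω → ∫⁻ x in s, ‖f x‖ₑ ^ 2 ∂(surfaceMeasure D)
        ≤ C * ((∫⁻ x in Ω, ‖f x‖ₑ ^ 2) + ∫⁻ x in Ω, ‖classicalGrad f x‖ₑ ^ 2)) ?_ ?_ ?_ ?_
    · exact ⟨0, by simp, fun f _ => by simp⟩
    · rintro s t hst ⟨C, hC, h⟩
      exact ⟨C, hC, fun f hf => (lintegral_mono_set hst).trans (h f hf)⟩
    · rintro s t ⟨C, hC, h⟩ ⟨C', hC', h'⟩
      refine ⟨C + C', ENNReal.add_ne_top.2 ⟨hC, hC'⟩, fun f hf => ?_⟩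
      rw [add_mul]
      exact (lintegral_union_le _ s t).trans (add_le_add (h f hf) (h' f hf))
    intro x hx
    obtain ⟨ρ, hρ, δ, hδ, v, hv, C, hC, -, hseg, hint⟩ :=
      exists_boundary_patch hΩ hD hD2 hx (hDΩ (frontier_subset_closure hx))
    refine ⟨_, inter_mem_nhdsWithin _ (Metric.ball_mem_nhds x hρ),
      (ENNReal.ofReal δ)⁻¹ * (2 + 2 * ENNReal.ofReal δ ^ 2) * C, ?_, fun f hf => ?_⟩
    · refine ENNReal.mul_ne_top (ENNReal.mul_ne_top ?_ ?_) hC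
      · simpa using hδ
      · exact ENNReal.add_ne_top.2 ⟨by simp, ENNReal.mul_ne_top (by simp) (by simp)⟩
    set S := frontier D ∩ Metric.ball x ρ
    have hSm : MeasurableSet S := isClosed_frontier.measurableSet.inter measurableSet_ball
    set F : Space d → ℝ≥0∞ := Ω.indicator fun x => ‖f x‖ₑ ^ 2
    set G : Space d → ℝ≥0∞ := Ω.indicator fun x => ‖classicalGrad f x‖ₑ ^ 2
    have hFm : Measurable F := measurable_indicator_enorm_sq hΩ hf.continuousOn
    have hGm : Measurable G := measurable_indicator_enorm_sq hΩ (continuousOn_classicalGrad hΩ hf)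
    have hδ0 : ENNReal.ofReal δ ≠ 0 := by simpa using hδ
    have hδt : ENNReal.ofReal δ ≠ ⊤ := ENNReal.ofReal_ne_top
    -- Average the estimate along the segment from `p` over its end point `p + t v`.
    have hpt : ∀ p ∈ S, ENNReal.ofReal δ * ‖f p‖ₑ ^ 2
        ≤ ∫⁻ t in Set.Icc 0 δ, (2 * F (p + t • v)
          + 2 * ENNReal.ofReal δ ^ 2 * G (p + t • v)) := by
      intro p hp
      have hmF : Measurable fun t : ℝ => F (p + t • v) :=
        hFm.comp (by fun_prop : Continuous fun t : ℝ => p + t • v).measurable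
      have hG : ∫⁻ s in Set.Icc 0 δ, ‖classicalGrad f (p + s • v)‖ₑ ^ 2
          = ∫⁻ s in Set.Icc 0 δ, G (p + s • v) :=
        setLIntegral_congr_fun measurableSet_Icc fun s hs =>
          (Set.indicator_of_mem (hseg p hp.2 s hs) (fun x => ‖classicalGrad f x‖ₑ ^ 2)).symm
      calc ENNReal.ofReal δ * ‖f p‖ₑ ^ 2 = ∫⁻ t in Set.Icc 0 δ, ‖f p‖ₑ ^ 2 := by
            rw [setLIntegral_const, Real.volume_Icc, sub_zero, mul_comm]
        _ ≤ ∫⁻ t in Set.Icc 0 δ, (2 * F (p + t • v)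
              + 2 * (ENNReal.ofReal δ * ∫⁻ s in Set.Icc 0 δ, G (p + s • v))) := by
            refine setLIntegral_mono' measurableSet_Icc fun t ht => ?_
            have h := enorm_sq_le_segment hΩ hf hv ht (hseg p hp.2)
            rw [hG] at h
            rwa [show F (p + t • v) = ‖f (p + t • v)‖ₑ ^ 2 from
              Set.indicator_of_mem (hseg p hp.2 t ht) _]
        _ = _ := by
            rw [lintegral_add_left (hmF.const_mul 2), lintegral_add_left (hmF.const_mul 2),
              setLIntegral_const, Real.volume_Icc, sub_zero, lintegral_const_mul' _ _
              (ENNReal.mul_ne_top (by simp) (by simp))]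
            ring
    -- Integrate over `p ∈ S` and use that the flow of `S` is dominated by Lebesgue measure.
    have hmain : ENNReal.ofReal δ * ∫⁻ p in S, ‖f p‖ₑ ^ 2
          ∂(Measure.euclideanHausdorffMeasure (d - 1))
        ≤ (2 + 2 * ENNReal.ofReal δ ^ 2) * C
          * ((∫⁻ x in Ω, ‖f x‖ₑ ^ 2) + ∫⁻ x in Ω, ‖classicalGrad f x‖ₑ ^ 2) := by
      calc _ = ∫⁻ p in S, ENNReal.ofReal δ * ‖f p‖ₑ ^ 2
            ∂(Measure.euclideanHausdorffMeasure (d - 1)) := (lintegral_const_mul' _ _ hδt).symm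
        _ ≤ _ := setLIntegral_mono' hSm hpt
        _ ≤ C * ∫⁻ y, (2 * F y + 2 * ENNReal.ofReal δ ^ 2 * G y) :=
            hint (fun y => 2 * F y + 2 * ENNReal.ofReal δ ^ 2 * G y)
              ((hFm.const_mul _).add (hGm.const_mul _))
        _ = C * (2 * (∫⁻ x in Ω, ‖f x‖ₑ ^ 2)
              + 2 * ENNReal.ofReal δ ^ 2 * ∫⁻ x in Ω, ‖classicalGrad f x‖ₑ ^ 2) := by
            rw [lintegral_add_left (hFm.const_mul _), lintegral_const_mul _ hFm,
              lintegral_const_mul _ hGm, lintegral_indicator hΩ.measurableSet,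
              lintegral_indicator hΩ.measurableSet]
        _ ≤ C * ((2 + 2 * ENNReal.ofReal δ ^ 2) * (∫⁻ x in Ω, ‖f x‖ₑ ^ 2)
              + (2 + 2 * ENNReal.ofReal δ ^ 2) * ∫⁻ x in Ω, ‖classicalGrad f x‖ₑ ^ 2) := by
            gcongr
            · exact le_self_add
            · exact le_add_self
        _ = _ := by ring
    have hrestrict : (surfaceMeasure D).restrict S
        = (Measure.euclideanHausdorffMeasure (d - 1)).restrict S := by
      rw [surfaceMeasure, Measure.restrict_restrict hSm,
        Set.inter_eq_left.2 Set.inter_subset_left]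
    rw [hrestrict]
    calc _ = (ENNReal.ofReal δ)⁻¹ * (ENNReal.ofReal δ * ∫⁻ p in S, ‖f p‖ₑ ^ 2
          ∂(Measure.euclideanHausdorffMeasure (d - 1))) := by
          rw [← mul_assoc, ENNReal.inv_mul_cancel hδ0 hδt, one_mul]
      _ ≤ (ENNReal.ofReal δ)⁻¹ * ((2 + 2 * ENNReal.ofReal δ ^ 2) * C
          * ((∫⁻ x in Ω, ‖f x‖ₑ ^ 2) + ∫⁻ x in Ω, ‖classicalGrad f x‖ₑ ^ 2)) := by gcongr
      _ = _ := by ring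
  simpa only [surfaceMeasure, Measure.restrict_restrict isClosed_frontier.measurableSet,
    Set.inter_self] using key

/-! ### Smooth functions as elements of the Sobolev spaces -/

lemma eLpNorm_two_sq {α E : Type*} [MeasurableSpace α] [NormedAddCommGroup E] (f : α → E)
    (μ : Measure α) : eLpNorm f 2 μ ^ 2 = ∫⁻ x, ‖f x‖ₑ ^ 2 ∂μ := by
  have h := eLpNorm_nnreal_pow_eq_lintegral (f := f) (μ := μ) (p := 2) (by norm_num)
  simpa using h

lemma tsupport_partialDeriv_subset {d : ℕ} {F : Type*} [NormedAddCommGroup F] [NormedSpace ℝ F]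
    (i : Fin d) (φ : Space d → F) : tsupport (partialDeriv i φ) ⊆ tsupport φ :=
  tsupport_fderiv_apply_subset ℝ _

lemma integrable_smul_of_tsupport_subset {d : ℕ} {Ω : Set (Space d)} (hΩ : IsOpen Ω)
    {φ : Space d → ℝ} (hc : Continuous φ) (hs : HasCompactSupport φ) (hsub : tsupport φ ⊆ Ω)
    {f : Space d → ℂ} (hf : ContinuousOn f Ω) : Integrable fun x => φ x • f x := by
  have hsupp : tsupport (fun x => φ x • f x) ⊆ tsupport φ := tsupport_smul_subset_left φ f
  refine Continuous.integrable_of_hasCompactSupport ?_ (hs.mono' (subset_closure.trans hsupp))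
  refine continuous_of_tsupport fun x hx => ?_
  exact hc.continuousAt.smul (hf.continuousAt (hΩ.mem_nhds (hsub (hsupp hx))))

lemma continuousOn_partialDeriv {d : ℕ} {Ω : Set (Space d)} (hΩ : IsOpen Ω) {f : Space d → ℂ}
    (hf : ContDiffOn ℝ ∞ f Ω) (i : Fin d) : ContinuousOn (partialDeriv i f) Ω :=
  (hf.continuousOn_fderiv_of_isOpen hΩ (by simp)).clm_apply continuousOn_const

lemma setIntegral_smul_eq_integral {d : ℕ} {Ω : Set (Space d)} {φ : Space d → ℝ}
    (hsub : tsupport φ ⊆ Ω) (f : Space d → ℂ) :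
    ∫ x in Ω, φ x • f x = ∫ x, φ x • f x := by
  refine setIntegral_eq_integral_of_forall_compl_eq_zero fun x hx => ?_
  rw [image_eq_zero_of_notMem_tsupport fun h => hx (hsub h), zero_smul]

/-- The classical gradient of a smooth function is a weak gradient. -/
lemma hasWeakGradient_classicalGrad {d : ℕ} {Ω : Set (Space d)} (hΩ : IsOpen Ω)
    {f : Space d → ℂ} (hf : ContDiffOn ℝ ∞ f Ω) : HasWeakGradient Ω f (classicalGrad f) := by
  intro φ hφ i
  have hsub' := (tsupport_partialDeriv_subset i φ).trans hφ.support_subset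
  rw [setIntegral_smul_eq_integral hsub']
  change _ = -∫ x in Ω, φ x • partialDeriv i f x
  rw [setIntegral_smul_eq_integral hφ.support_subset, eq_neg_iff_add_eq_zero, add_comm,
    ← eq_neg_iff_add_eq_zero]
  refine integral_smul_fderiv_eq_neg_fderiv_smul_of_integrable ?_ ?_ ?_ ?_ ?_
  · exact integrable_smul_of_tsupport_subset hΩ (hφ.continuous_partialDeriv i)
      (hφ.hasCompactSupport_partialDeriv i) hsub' hf.continuousOn
  · exact integrable_smul_of_tsupport_subset hΩ hφ.smooth.continuous hφ.compact
      hφ.support_subset (continuousOn_partialDeriv hΩ hf i)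
  · exact integrable_smul_of_tsupport_subset hΩ hφ.smooth.continuous hφ.compact
      hφ.support_subset hf.continuousOn
  · exact fun x _ => (hφ.smooth.differentiable (by simp)) x
  · exact fun x hx => (hf.contDiffAt (hΩ.mem_nhds (hφ.support_subset hx))).differentiableAt
      (by simp)

lemma HasWeakGradient.congr_ae {d : ℕ} {Ω : Set (Space d)} {u u' : Space d → ℂ}
    {G G' : Space d → CVec d} (h : HasWeakGradient Ω u G) (hu : u' =ᵐ[volume.restrict Ω] u)
    (hG : G' =ᵐ[volume.restrict Ω] G) : HasWeakGradient Ω u' G' := by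
  intro φ hφ i
  have e1 : ∫ x in Ω, partialDeriv i φ x • u' x = ∫ x in Ω, partialDeriv i φ x • u x := by
    refine integral_congr_ae ?_
    filter_upwards [hu] with x hx
    rw [hx]
  have e2 : ∫ x in Ω, φ x • G' x i = ∫ x in Ω, φ x • G x i := by
    refine integral_congr_ae ?_
    filter_upwards [hG] with x hx
    rw [hx]
  rw [e1, e2, h φ hφ i]

/-- If an element of `H¹(Ω)` is given by a smooth function, its weak gradient is the classical
gradient of that function. -/
lemma H1grad_ae_eq_classicalGrad {d : ℕ} {Ω : Set (Space d)} (hΩ : IsOpen Ω) {w : H1 Ω}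
    {f : Space d → ℂ} (hf : ContDiffOn ℝ ∞ f Ω) (hw : H1fn w =ᵐ[volume.restrict Ω] f) :
    H1grad w =ᵐ[volume.restrict Ω] classicalGrad f := by
  have hcoord : ∀ i : Fin d, ∀ᵐ x ∂(volume : Measure (Space d)), x ∈ Ω →
      H1grad w x i - classicalGrad f x i = 0 := by
    intro i
    have hGi : MemLp (fun x => H1grad w x i) 2 (volume.restrict Ω) := memLp_coord w.1.snd i
    have hfi : LocallyIntegrableOn (fun x => classicalGrad f x i) Ω :=
      (continuousOn_partialDeriv hΩ hf i).locallyIntegrableOn hΩ.measurableSet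
    refine hΩ.ae_eq_zero_of_integral_contDiff_smul_eq_zero
      ((locallyIntegrableOn_of_locallyIntegrable_restrict
        (hGi.locallyIntegrable (by norm_num))).sub hfi) fun φ hφs hφc hφΩ => ?_
    have hφ : IsTestFunction Ω φ := ⟨hφs, hφc, hφΩ⟩
    have h1 := w.2 φ hφ i
    have h2 := hasWeakGradient_classicalGrad hΩ hf φ hφ i
    have h3 : ∫ x in Ω, partialDeriv i φ x • w.1.fst x = ∫ x in Ω, partialDeriv i φ x • f x := by
      refine integral_congr_ae ?_
      filter_upwards [hw] with x hx
      exact congrArg _ hx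
    have h4 : ∫ x in Ω, φ x • H1grad w x i = ∫ x in Ω, φ x • classicalGrad f x i :=
      neg_inj.1 (h1.symm.trans (h3.trans h2))
    rw [← setIntegral_smul_eq_integral hφΩ]
    simp_rw [smul_sub]
    rw [integral_sub, h4, sub_self]
    · exact integrable_smul_of_bounded hφs.continuous hφc hGi
    · exact (integrable_smul_of_tsupport_subset hΩ hφs.continuous hφc hφΩ
        (continuousOn_partialDeriv hΩ hf i)).integrableOn
  have hall := (ae_all_iff.2 hcoord)
  filter_upwards [ae_restrict_of_ae hall, ae_restrict_mem hΩ.measurableSet] with x hx hxΩ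
  ext i
  exact sub_eq_zero.1 (hx i hxΩ)

lemma IsTestFunction.mono {d : ℕ} {F : Type*} [NormedAddCommGroup F] [NormedSpace ℝ F]
    {U V : Set (Space d)} {φ : Space d → F} (hφ : IsTestFunction U φ) (h : U ⊆ V) :
    IsTestFunction V φ :=
  ⟨hφ.smooth, hφ.compact, hφ.support_subset.trans h⟩

lemma IsTestFunction.add {d : ℕ} {U : Set (Space d)} {φ ψ : Space d → ℂ}
    (hφ : IsTestFunction U φ) (hψ : IsTestFunction U ψ) : IsTestFunction U (φ + ψ) :=
  ⟨hφ.smooth.add hψ.smooth, hφ.compact.add hψ.compact,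
    (tsupport_add φ ψ).trans (Set.union_subset hφ.support_subset hψ.support_subset)⟩

lemma IsTestFunction.const_smul {d : ℕ} {U : Set (Space d)} {φ : Space d → ℂ}
    (hφ : IsTestFunction U φ) (c : ℂ) : IsTestFunction U (c • φ) :=
  ⟨contDiff_const.smul hφ.smooth,
    hφ.compact.mono (Function.support_const_smul_subset c φ),
    (closure_mono (Function.support_const_smul_subset c φ)).trans hφ.support_subset⟩

lemma IsTestFunction.zero {d : ℕ} {U : Set (Space d)} :
    IsTestFunction U (0 : Space d → ℂ) :=
  ⟨contDiff_const, HasCompactSupport.zero, by simp [tsupport]⟩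

lemma continuous_classicalGrad {d : ℕ} {φ : Space d → ℂ} (hφ : ContDiff ℝ ∞ φ) :
    Continuous (classicalGrad φ) :=
  continuousOn_univ.1 (continuousOn_classicalGrad isOpen_univ hφ.contDiffOn)

lemma classicalGrad_eq_zero {d : ℕ} {φ : Space d → ℂ} {x : Space d} (hx : x ∉ tsupport φ) :
    classicalGrad φ x = 0 := by
  ext i
  change partialDeriv i φ x = 0
  exact image_eq_zero_of_notMem_tsupport fun h => hx (tsupport_partialDeriv_subset i φ h)

lemma IsTestFunction.memLp {d : ℕ} {U : Set (Space d)} {φ : Space d → ℂ}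
    (hφ : IsTestFunction U φ) (Ω : Set (Space d)) : MemLp φ 2 (volume.restrict Ω) :=
  hφ.smooth.continuous.memLp_of_hasCompactSupport hφ.compact

lemma IsTestFunction.memLp_classicalGrad {d : ℕ} {U : Set (Space d)} {φ : Space d → ℂ}
    (hφ : IsTestFunction U φ) (Ω : Set (Space d)) :
    MemLp (classicalGrad φ) 2 (volume.restrict Ω) := by
  refine (continuous_classicalGrad hφ.smooth).memLp_of_hasCompactSupport ?_
  refine hφ.compact.mono' fun x hx => ?_
  by_contra h
  exact hx (classicalGrad_eq_zero h)

lemma IsTestFunction.exists_H1 {d : ℕ} {Ω : Set (Space d)} (hΩ : IsOpen Ω) {φ : Space d → ℂ}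
    (hφ : IsTestFunction Ω φ) : ∃ w ∈ H10 Ω, H1fn w =ᵐ[volume.restrict Ω] φ := by
  have h1 := (hφ.memLp Ω).coeFn_toLp
  have h2 := (hφ.memLp_classicalGrad Ω).coeFn_toLp
  let w : H1 Ω := ⟨WithLp.toLp 2 ((hφ.memLp Ω).toLp φ, (hφ.memLp_classicalGrad Ω).toLp _),
    (hasWeakGradient_classicalGrad hΩ hφ.smooth.contDiffOn).congr_ae h1 h2⟩
  exact ⟨w, Submodule.le_topologicalClosure _ (Submodule.subset_span ⟨φ, hφ, h1⟩), h1⟩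

lemma H1fn_add {d : ℕ} {Ω : Set (Space d)} (u v : H1 Ω) :
    H1fn (u + v) =ᵐ[volume.restrict Ω] H1fn u + H1fn v :=
  Lp.coeFn_add _ _

lemma H1fn_sub {d : ℕ} {Ω : Set (Space d)} (u v : H1 Ω) :
    H1fn (u - v) =ᵐ[volume.restrict Ω] H1fn u - H1fn v :=
  Lp.coeFn_sub _ _

lemma H1fn_smul {d : ℕ} {Ω : Set (Space d)} (c : ℂ) (u : H1 Ω) :
    H1fn (c • u) =ᵐ[volume.restrict Ω] c • H1fn u :=
  Lp.coeFn_smul _ _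

/-- The set of classes of test functions is already a linear subspace. -/
lemma exists_test_of_mem_span {d : ℕ} {Ω : Set (Space d)} {w : H1 Ω}
    (hw : w ∈ Submodule.span ℂ (testClasses Ω)) :
    ∃ φ : Space d → ℂ, IsTestFunction Ω φ ∧ H1fn w =ᵐ[volume.restrict Ω] φ := by
  induction hw using Submodule.span_induction with
  | mem x h => exact h
  | zero => exact ⟨0, IsTestFunction.zero, Lp.coeFn_zero _ _ _⟩
  | add x y _ _ hx hy =>
    obtain ⟨φ, hφ, h1⟩ := hx
    obtain ⟨ψ, hψ, h2⟩ := hy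
    exact ⟨φ + ψ, hφ.add hψ, (H1fn_add x y).trans (h1.add h2)⟩
  | smul c x _ hx =>
    obtain ⟨φ, hφ, h1⟩ := hx
    exact ⟨c • φ, hφ.const_smul c, (H1fn_smul c x).trans (h1.const_smul c)⟩

lemma enorm_fst_sq {d : ℕ} {Ω : Set (Space d)} {w : H1 Ω} {f : Space d → ℂ}
    (hw : H1fn w =ᵐ[volume.restrict Ω] f) : ‖w.1.fst‖ₑ ^ 2 = ∫⁻ x in Ω, ‖f x‖ₑ ^ 2 := by
  rw [← eLpNorm_two_sq, Lp.enorm_def]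
  exact congrArg (· ^ 2) (eLpNorm_congr_ae hw)

lemma enorm_snd_sq {d : ℕ} {Ω : Set (Space d)} {w : H1 Ω} {G : Space d → CVec d}
    (hw : H1grad w =ᵐ[volume.restrict Ω] G) : ‖w.1.snd‖ₑ ^ 2 = ∫⁻ x in Ω, ‖G x‖ₑ ^ 2 := by
  rw [← eLpNorm_two_sq, Lp.enorm_def]
  exact congrArg (· ^ 2) (eLpNorm_congr_ae hw)

lemma H1_norm_sq {d : ℕ} {Ω : Set (Space d)} (w : H1 Ω) :
    ‖w‖ ^ 2 = ‖w.1.fst‖ ^ 2 + ‖w.1.snd‖ ^ 2 :=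
  WithLp.prod_norm_sq_eq_of_L2 w.1

lemma H1_enorm_sq {d : ℕ} {Ω : Set (Space d)} (w : H1 Ω) :
    ‖w‖ₑ ^ 2 = ‖w.1.fst‖ₑ ^ 2 + ‖w.1.snd‖ₑ ^ 2 := by
  have h : ‖w‖₊ ^ 2 = ‖w.1.fst‖₊ ^ 2 + ‖w.1.snd‖₊ ^ 2 :=
    NNReal.eq (by push_cast; exact H1_norm_sq w)
  simp only [enorm_eq_nnnorm]
  exact_mod_cast h

/-! ### The trace operator -/

/-- The trace inequality for elements of `H¹(Ω)` given by smooth functions. -/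
lemma exists_trace_bound {d : ℕ} {Ω D : Set (Space d)} (hΩ : IsOpen Ω)
    (hΩb : Bornology.IsBounded Ω) (hD : IsOpen D) (hDΩ : closure D ⊆ Ω) (hD2 : HasC2Boundary D) :
    ∃ C : ℝ≥0, ∀ (w : H1 Ω) (f : Space d → ℂ), ContDiffOn ℝ ∞ f Ω →
      H1fn w =ᵐ[volume.restrict Ω] f → eLpNorm f 2 (surfaceMeasure D) ≤ C * ‖w‖ₑ := by
  obtain ⟨C, hC, h⟩ := trace_inequality hΩ hΩb hD hDΩ hD2
  lift C to ℝ≥0 using hC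
  refine ⟨NNReal.sqrt C, fun w f hf hw => ?_⟩
  refine (ENNReal.pow_le_pow_left_iff two_ne_zero).1 ?_
  rw [eLpNorm_two_sq, mul_pow, H1_enorm_sq, enorm_fst_sq hw,
    enorm_snd_sq (H1grad_ae_eq_classicalGrad hΩ hf hw), ← ENNReal.coe_pow, NNReal.sq_sqrt]
  exact h f hf

lemma aestronglyMeasurable_surface {d : ℕ} {Ω D : Set (Space d)} (hDΩ : closure D ⊆ Ω)
    {f : Space d → ℂ} (hf : ContDiffOn ℝ ∞ f Ω) :
    AEStronglyMeasurable f (surfaceMeasure D) :=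
  (hf.continuousOn.mono (frontier_subset_closure.trans hDΩ)).aestronglyMeasurable
    isClosed_frontier.measurableSet

section Trace

variable {d : ℕ} {Ω D : Set (Space d)}

lemma IsTrace.add (hDΩ : closure D ⊆ Ω) {w w' : H1 Ω} {τ τ' : L2Boundary D}
    (h : IsTrace D w τ) (h' : IsTrace D w' τ') : IsTrace D (w + w') (τ + τ') := by
  obtain ⟨u, φ, hφ, hu, hτ⟩ := h
  obtain ⟨u', φ', hφ', hu', hτ'⟩ := h'
  refine ⟨fun n => u n + u' n, fun n => φ n + φ' n, fun n => ⟨(hφ n).1.add (hφ' n).1,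
    (H1fn_add _ _).trans ((hφ n).2.add (hφ' n).2)⟩, hu.add hu', ?_⟩
  refine tendsto_of_tendsto_of_tendsto_of_le_of_le tendsto_const_nhds
    (by simpa using hτ.add hτ') (fun n => zero_le) fun n => ?_
  have hm := aestronglyMeasurable_surface hDΩ (hφ n).1
  have hm' := aestronglyMeasurable_surface hDΩ (hφ' n).1
  refine le_trans (le_of_eq ?_) (eLpNorm_add_le (hm.sub (Lp.aestronglyMeasurable τ))
    (hm'.sub (Lp.aestronglyMeasurable τ')) (by norm_num))
  refine eLpNorm_congr_ae ?_
  filter_upwards [Lp.coeFn_add τ τ'] with x hx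
  simp only [hx, Pi.add_apply]
  ring

lemma IsTrace.smul {w : H1 Ω} {τ : L2Boundary D} (c : ℂ)
    (h : IsTrace D w τ) : IsTrace D (c • w) (c • τ) := by
  obtain ⟨u, φ, hφ, hu, hτ⟩ := h
  refine ⟨fun n => c • u n, fun n => c • φ n, fun n => ⟨contDiffOn_const.smul (hφ n).1,
    (H1fn_smul _ _).trans ((hφ n).2.const_smul c)⟩, hu.const_smul c, ?_⟩
  have h0 := ENNReal.Tendsto.const_mul (a := ‖c‖ₑ) hτ (Or.inr (by simp))
  rw [mul_zero] at h0
  refine h0.congr fun n => ?_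
  rw [← eLpNorm_const_smul]
  refine eLpNorm_congr_ae ?_
  filter_upwards [Lp.coeFn_smul c τ] with x hx
  simp only [hx, Pi.smul_apply, smul_sub]

/-- The trace inequality passes to the limit. -/
lemma IsTrace.norm_le {C : ℝ≥0} (hDΩ : closure D ⊆ Ω)
    (hC : ∀ (w : H1 Ω) (f : Space d → ℂ), ContDiffOn ℝ ∞ f Ω →
      H1fn w =ᵐ[volume.restrict Ω] f → eLpNorm f 2 (surfaceMeasure D) ≤ C * ‖w‖ₑ)
    {w : H1 Ω} {τ : L2Boundary D} (h : IsTrace D w τ) : ‖τ‖ ≤ C * ‖w‖ := by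
  obtain ⟨u, φ, hφ, hu, hτ⟩ := h
  have hle : ∀ n, ‖τ‖ₑ
      ≤ eLpNorm (fun x => φ n x - τ x) 2 (surfaceMeasure D) + C * ‖u n‖ₑ := by
    intro n
    have hm := aestronglyMeasurable_surface hDΩ (hφ n).1
    calc ‖τ‖ₑ = eLpNorm (fun x => φ n x - (φ n x - τ x)) 2 (surfaceMeasure D) := by
          simp [Lp.enorm_def]
      _ ≤ eLpNorm (φ n) 2 (surfaceMeasure D)
            + eLpNorm (fun x => φ n x - τ x) 2 (surfaceMeasure D) :=
          eLpNorm_sub_le hm (hm.sub (Lp.aestronglyMeasurable τ)) (by norm_num)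
      _ ≤ _ := by
          rw [add_comm]
          gcongr
          exact hC _ _ (hφ n).1 (hφ n).2
  have hlim : Tendsto (fun n => eLpNorm (fun x => φ n x - τ x) 2 (surfaceMeasure D)
      + C * ‖u n‖ₑ) atTop (𝓝 (0 + C * ‖w‖ₑ)) :=
    hτ.add (ENNReal.Tendsto.const_mul ((continuous_enorm.tendsto w).comp hu) (Or.inr (by simp)))
  have := ge_of_tendsto' hlim hle
  rw [zero_add] at this
  simp only [enorm_eq_nnnorm] at this
  exact_mod_cast this

lemma IsTrace.unique (hΩ : IsOpen Ω) (hΩb : Bornology.IsBounded Ω) (hD : IsOpen D)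
    (hDΩ : closure D ⊆ Ω) (hD2 : HasC2Boundary D) {w : H1 Ω} {τ τ' : L2Boundary D}
    (h : IsTrace D w τ) (h' : IsTrace D w τ') : τ = τ' := by
  obtain ⟨C, hC⟩ := exists_trace_bound hΩ hΩb hD hDΩ hD2
  have := (h.add hDΩ (h'.smul (-1))).norm_le hDΩ hC
  simpa [add_neg_eq_zero] using this

/-- Restrictions of test functions which converge in `H¹(Ω)` form a Cauchy sequence in `L²(∂D)`. -/
lemma exists_isTrace (hΩ : IsOpen Ω) (hΩb : Bornology.IsBounded Ω) (hD : IsOpen D)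
    (hDΩ : closure D ⊆ Ω) (hD2 : HasC2Boundary D) {w : H1 Ω} (hw : w ∈ H10 Ω) :
    ∃ τ : L2Boundary D, IsTrace D w τ := by
  obtain ⟨C, hC⟩ := exists_trace_bound hΩ hΩb hD hDΩ hD2
  obtain ⟨u, hus, hu⟩ := mem_closure_iff_seq_limit.1 hw
  choose φ hφ hφu using fun n => exists_test_of_mem_span (hus n)
  have hmem : ∀ n, MemLp (φ n) 2 (surfaceMeasure D) := fun n =>
    ⟨aestronglyMeasurable_surface hDΩ (hφ n).smooth.contDiffOn,
      (hC _ _ (hφ n).smooth.contDiffOn (hφu n)).trans_lt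
        (ENNReal.mul_lt_top (by simp) (by simp))⟩
  have hcauchy : CauchySeq fun n => (hmem n).toLp (φ n) := by
    rw [cauchySeq_iff_tendsto_dist_atTop_0]
    have h0 := (cauchySeq_iff_tendsto_dist_atTop_0.1 hu.cauchySeq).const_mul (C : ℝ)
    rw [mul_zero] at h0
    refine squeeze_zero (fun _ => dist_nonneg) (fun p => ?_) h0
    have h1 := hC (u p.1 - u p.2) (φ p.1 - φ p.2)
      ((hφ p.1).smooth.sub (hφ p.2).smooth).contDiffOn
      ((H1fn_sub _ _).trans ((hφu p.1).sub (hφu p.2)))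
    rw [dist_eq_norm, dist_eq_norm, ← MemLp.toLp_sub, Lp.norm_toLp]
    refine ENNReal.toReal_le_of_le_ofReal (by positivity) (h1.trans_eq ?_)
    rw [ENNReal.ofReal_mul C.coe_nonneg, ofReal_norm, ENNReal.ofReal_coe_nnreal]
  obtain ⟨τ, hτ⟩ := cauchySeq_tendsto_of_complete hcauchy
  refine ⟨τ, u, φ, fun n => ⟨(hφ n).smooth.contDiffOn, hφu n⟩, hu, ?_⟩
  have h1 := (Lp.tendsto_Lp_iff_tendsto_eLpNorm' _ τ).1 hτ
  refine h1.congr fun n => eLpNorm_congr_ae ?_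
  filter_upwards [(hmem n).coeFn_toLp] with x hx
  simp [hx]

/-- The trace as a bounded operator `H¹₀(Ω) → L²(∂D)`. -/
lemma exists_traceOperator (hΩ : IsOpen Ω) (hΩb : Bornology.IsBounded Ω) (hD : IsOpen D)
    (hDΩ : closure D ⊆ Ω) (hD2 : HasC2Boundary D) :
    ∃ R : H10 Ω →L[ℂ] L2Boundary D, ∀ w : H10 Ω, IsTrace D w.1 (R w) := by
  obtain ⟨C, hC⟩ := exists_trace_bound hΩ hΩb hD hDΩ hD2
  choose R hR using fun w : H10 Ω => exists_isTrace hΩ hΩb hD hDΩ hD2 w.2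
  let L : H10 Ω →ₗ[ℂ] L2Boundary D :=
    { toFun := R
      map_add' := fun v w => (hR (v + w)).unique hΩ hΩb hD hDΩ hD2 ((hR v).add hDΩ (hR w))
      map_smul' := fun c w => (hR (c • w)).unique hΩ hΩb hD hDΩ hD2 ((hR w).smul c) }
  exact ⟨L.mkContinuous C fun w => (hR w).norm_le hDΩ hC, hR⟩

/-- A function which is smooth on `Ω` and vanishes on `∂D` has trace zero. -/
lemma isTrace_zero_of_forall_frontier {w : H1 Ω} {φ : Space d → ℂ} (hφ : ContDiffOn ℝ ∞ φ Ω)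
    (hw : H1fn w =ᵐ[volume.restrict Ω] φ) (h0 : ∀ x ∈ frontier D, φ x = 0) :
    IsTrace D w 0 := by
  refine ⟨fun _ => w, fun _ => φ, fun _ => ⟨hφ, hw⟩, tendsto_const_nhds, ?_⟩
  have : eLpNorm (fun x => φ x - (0 : L2Boundary D) x) 2 (surfaceMeasure D) = 0 := by
    rw [← eLpNorm_zero (ε := ℂ) (p := 2) (μ := surfaceMeasure D)]
    refine eLpNorm_congr_ae ?_
    filter_upwards [Lp.coeFn_zero ℂ 2 (surfaceMeasure D),
      ae_restrict_mem isClosed_frontier.measurableSet] with x hx hxD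
    rw [hx, h0 x hxD]
    simp
  simp only [this]
  exact tendsto_const_nhds

end Trace

/-! ### Completeness and the Poincaré inequality -/

/-- `H¹(Ω)` is closed in `L²(Ω) × L²(Ω)ᵈ`: the conditions that define a weak gradient are
orthogonality relations. -/
lemma isClosed_H1 {d : ℕ} (Ω : Set (Space d)) : IsClosed (H1 Ω : Set (L2Pair Ω)) := by
  have hset : (H1 Ω : Set (L2Pair Ω)) = ⋂ (φ : Space d → ℝ) (_ : IsTestFunction Ω φ) (i : Fin d),
      {p : L2Pair Ω | ∫ x in Ω, partialDeriv i φ x • p.fst x = - ∫ x in Ω, φ x • p.snd x i} := by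
    ext p
    simp only [Set.mem_iInter]
    rfl
  have hcont : ∀ ψ : Space d → ℝ, Continuous ψ → HasCompactSupport ψ →
      Continuous fun u : Lp ℂ 2 (volume.restrict Ω) => ∫ x in Ω, ψ x • u x := by
    intro ψ hψ hψs
    have hm : MemLp (fun x => (ψ x : ℂ)) 2 (volume.restrict Ω) :=
      (hψ.memLp_of_hasCompactSupport hψs).ofReal
    have : (fun u : Lp ℂ 2 (volume.restrict Ω) => ∫ x in Ω, ψ x • u x)
        = fun u => inner ℂ (hm.toLp _) u := by
      ext u
      rw [L2.inner_def]
      refine integral_congr_ae ?_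
      filter_upwards [hm.coeFn_toLp] with x hx
      simp [hx, mul_comm]
    rw [this]
    fun_prop
  rw [hset]
  refine isClosed_iInter fun φ => isClosed_iInter fun hφ => isClosed_iInter fun i => ?_
  refine isClosed_eq ?_ ?_
  · exact (hcont _ (hφ.continuous_partialDeriv i) (hφ.hasCompactSupport_partialDeriv i)).comp
      (WithLp.prod_continuous_ofLp 2 _ _).fst
  · have h1 : (fun p : L2Pair Ω => ∫ x in Ω, φ x • p.snd x i)
        = fun p => ∫ x in Ω, φ x
          • (EuclideanSpace.proj (𝕜 := ℂ) i).compLp p.snd x := by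
      ext p
      refine integral_congr_ae ?_
      filter_upwards [(EuclideanSpace.proj (𝕜 := ℂ) i).coeFn_compLp p.snd] with x hx
      rw [hx]
      rfl
    have h2 : Continuous fun p : L2Pair Ω => (EuclideanSpace.proj (𝕜 := ℂ) i).compLp p.snd :=
      ((EuclideanSpace.proj (𝕜 := ℂ) i : CVec d →L[ℂ] ℂ).compLpL 2
        (volume.restrict Ω)).continuous.comp (WithLp.prod_continuous_ofLp 2 _ _).snd
    have h3 : Continuous fun p : L2Pair Ω => ∫ x in Ω, φ x
        • (EuclideanSpace.proj (𝕜 := ℂ) i).compLp p.snd x :=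
      (hcont _ hφ.smooth.continuous hφ.compact).comp h2
    rw [← h1] at h3
    exact h3.neg

instance completeSpace_H10 {d : ℕ} (Ω : Set (Space d)) : CompleteSpace (H10 Ω) := by
  have : CompleteSpace (H1 Ω) := (isClosed_H1 Ω).completeSpace_coe
  exact (Submodule.isClosed_topologicalClosure _).completeSpace_coe

/-- The Poincaré inequality for test functions: in a fixed direction, every segment of length `2R`
that starts in `Ω ⊆ B(0, R)` ends outside of `Ω`. -/
lemma poincare_test {d : ℕ} (hd : 2 ≤ d) {Ω : Set (Space d)} (hΩ : IsOpen Ω)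
    (hΩb : Bornology.IsBounded Ω) :
    ∃ C : ℝ≥0∞, C ≠ ⊤ ∧ ∀ φ : Space d → ℂ, IsTestFunction Ω φ →
      ∫⁻ x in Ω, ‖φ x‖ₑ ^ 2 ≤ C * ∫⁻ x in Ω, ‖classicalGrad φ x‖ₑ ^ 2 := by
  obtain ⟨R, hR, hΩR⟩ := hΩb.subset_ball_lt 0 0
  set v : Space d := EuclideanSpace.single ⟨0, by omega⟩ 1
  have hv : ‖v‖ = 1 := by simp [v]
  refine ⟨2 * (ENNReal.ofReal (2 * R) * ENNReal.ofReal (2 * R)),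
    ENNReal.mul_ne_top (by simp)
      (ENNReal.mul_ne_top ENNReal.ofReal_ne_top ENNReal.ofReal_ne_top), fun φ hφ => ?_⟩
  set I := Set.Icc (0 : ℝ) (2 * R)
  have hI : 2 * R ∈ I := ⟨by positivity, le_rfl⟩
  set G : Space d → ℝ≥0∞ := fun x => ‖classicalGrad φ x‖ₑ ^ 2
  have hG : Measurable G :=
    ((ENNReal.continuous_pow 2).comp (continuous_classicalGrad hφ.smooth).enorm).measurable
  have hpt : ∀ p ∈ Ω, ‖φ p‖ₑ ^ 2
      ≤ 2 * ENNReal.ofReal (2 * R) * ∫⁻ s in I, G (p + s • v) := by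
    intro p hp
    have h0 : φ (p + (2 * R) • v) = 0 := by
      refine image_eq_zero_of_notMem_tsupport fun h => ?_
      have h1 : ‖p + (2 * R) • v‖ < R := by simpa using hΩR (hφ.support_subset h)
      have h2 : ‖p‖ < R := by simpa using hΩR hp
      have h3 : ‖(2 * R) • v‖ = 2 * R := by
        rw [norm_smul, hv, mul_one, Real.norm_eq_abs, abs_of_pos (by positivity)]
      have h4 : ‖(2 * R) • v‖ ≤ ‖p + (2 * R) • v‖ + ‖p‖ := by
        simpa using norm_sub_le (p + (2 * R) • v) p
      linarith
    have h := enorm_sq_le_segment isOpen_univ hφ.smooth.contDiffOn (p := p) hv hI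
      fun _ _ => Set.mem_univ _
    rw [h0] at h
    simpa [G, mul_assoc] using h
  calc ∫⁻ x in Ω, ‖φ x‖ₑ ^ 2
      ≤ ∫⁻ p in Ω, 2 * ENNReal.ofReal (2 * R) * ∫⁻ s in I, G (p + s • v) :=
        setLIntegral_mono' hΩ.measurableSet hpt
    _ ≤ ∫⁻ p, 2 * ENNReal.ofReal (2 * R) * ∫⁻ s in I, G (p + s • v) :=
        setLIntegral_le_lintegral _ _
    _ = 2 * ENNReal.ofReal (2 * R) * ∫⁻ s in I, ∫⁻ p, G (p + s • v) := by
        rw [lintegral_const_mul' _ _ (ENNReal.mul_ne_top (by simp) ENNReal.ofReal_ne_top),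
          lintegral_lintegral_swap]
        exact (hG.comp (by fun_prop : Continuous fun q : Space d × ℝ =>
          q.1 + q.2 • v).measurable).aemeasurable
    _ = 2 * (ENNReal.ofReal (2 * R) * ENNReal.ofReal (2 * R)) * ∫⁻ x, G x := by
        simp_rw [lintegral_add_right_eq_self G]
        rw [setLIntegral_const, Real.volume_Icc, sub_zero]
        ring
    _ = _ := by
        congr 1
        refine (setLIntegral_eq_of_support_subset fun x hx => ?_).symm
        by_contra h
        refine hx ?_
        simp [G, classicalGrad_eq_zero fun h' => h (hφ.support_subset h')]

/-- The Poincaré inequality on `H¹₀(Ω)`. -/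
lemma exists_poincare {d : ℕ} (hd : 2 ≤ d) {Ω : Set (Space d)} (hΩ : IsOpen Ω)
    (hΩb : Bornology.IsBounded Ω) :
    ∃ c : ℝ≥0, 0 < c ∧ ∀ w ∈ H10 Ω, ‖w‖ ^ 2 * c ≤ ‖w.1.snd‖ ^ 2 := by
  obtain ⟨C, hC, h⟩ := poincare_test hd hΩ hΩb
  lift C to ℝ≥0 using hC
  refine ⟨(C + 1)⁻¹, by positivity, fun w hw => ?_⟩
  have hclosed : IsClosed {w : H1 Ω | ‖w‖ ^ 2 * ((C + 1)⁻¹ : ℝ≥0) ≤ ‖w.1.snd‖ ^ 2} := by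
    have : Continuous fun w : H1 Ω => w.1.snd :=
      ((WithLp.prod_continuous_ofLp 2 _ _).snd).comp continuous_subtype_val
    exact isClosed_le (by fun_prop) (by fun_prop)
  refine closure_minimal (fun u hu => ?_) hclosed hw
  obtain ⟨φ, hφ, hu⟩ := exists_test_of_mem_span hu
  have h1 := h φ hφ
  rw [← enorm_fst_sq hu, ← enorm_snd_sq
    (H1grad_ae_eq_classicalGrad hΩ hφ.smooth.contDiffOn hu)] at h1
  simp only [enorm_eq_nnnorm] at h1
  have h2 : ‖u.1.fst‖ ^ 2 ≤ C * ‖u.1.snd‖ ^ 2 := by exact_mod_cast h1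
  have h3 : (0 : ℝ) < C + 1 := by positivity
  rw [Set.mem_ofPred_eq, H1_norm_sq]
  push_cast
  rw [← div_eq_mul_inv, div_le_iff₀ h3]
  linarith

/-! ### The variational formulation -/

lemma setIntegral_diff_frontier {d : ℕ} {Ω D : Set (Space d)} (h0 : volume (frontier D) = 0)
    (f : Space d → ℂ) : ∫ x in Ω \ frontier D, f x = ∫ x in Ω, f x :=
  setIntegral_congr_set (sdiff_null_ae_eq_self h0)

lemma setIntegral_exterior_add_interior {d : ℕ} {Ω D : Set (Space d)}
    (hD : IsOpen D) (hDΩ : closure D ⊆ Ω) (h0 : volume (frontier D) = 0) {f : Space d → ℂ}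
    (hf : IntegrableOn f Ω) :
    (∫ x in Ω \ closure D, f x) + ∫ x in D, f x = ∫ x in Ω, f x := by
  have hDsub : D ⊆ Ω := subset_closure.trans hDΩ
  have hset : Ω \ frontier D = (Ω \ closure D) ∪ D := by
    rw [hD.frontier_eq, Set.sdiff_sdiff_right, Set.inter_eq_right.2 hDsub]
  rw [← setIntegral_diff_frontier (Ω := Ω) h0, hset, setIntegral_union _ hD.measurableSet
    (hf.mono_set Set.sdiff_subset) (hf.mono_set hDsub)]
  exact Set.disjoint_left.2 fun x hx hxD => hx.2 (subset_closure hxD)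

/-- The gradient `H¹₀(Ω) → L²(Ω)ᵈ`. -/
def gradL {d : ℕ} (Ω : Set (Space d)) : H10 Ω →L[ℂ] Lp (CVec d) 2 (volume.restrict Ω) :=
  (WithLp.sndL 2 ℂ _ _).comp ((H1 Ω).subtypeL.comp (H10 Ω).subtypeL)

lemma inner_gradL {d : ℕ} {Ω : Set (Space d)} (φ w : H10 Ω) :
    inner ℂ (gradL Ω φ) (gradL Ω w) = ∫ x in Ω, inner ℂ (H1grad φ.1 x) (H1grad w.1 x) :=
  L2.inner_def _ _

/-- Since `∂D` is a null set, the one-sided normal derivatives combine to the Dirichlet form on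
`Ω`. -/
lemma normal_jump_eq {d : ℕ} {Ω D : Set (Space d)}
    (hD : IsOpen D) (hDΩ : closure D ⊆ Ω) (h0 : volume (frontier D) = 0) (φ w : H10 Ω) :
    exteriorNormalDeriv D w.1 φ.1 - interiorNormalDeriv D w.1 φ.1
      = - inner ℂ (gradL Ω φ) (gradL Ω w) := by
  have hint : IntegrableOn (fun x => (inner ℂ (H1grad φ.1 x) (H1grad w.1 x) : ℂ)) Ω :=
    L2.integrable_inner (𝕜 := ℂ) φ.1.1.snd w.1.1.snd
  rw [inner_gradL, ← setIntegral_exterior_add_interior hD hDΩ h0 hint, exteriorNormalDeriv,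
    interiorNormalDeriv]
  ring

/-- The Lax–Milgram theorem for the coercive form `(G w, G φ)`: the equation
`(G w, G φ) = - (M h, R φ)` for all `φ` has exactly one solution, which depends continuously and
linearly on `h`. -/
lemma exists_solutionOperator {V H K : Type*}
    [NormedAddCommGroup V] [InnerProductSpace ℂ V] [CompleteSpace V]
    [NormedAddCommGroup H] [InnerProductSpace ℂ H] [CompleteSpace H]
    [NormedAddCommGroup K] [InnerProductSpace ℂ K] [CompleteSpace K]
    (G : V →L[ℂ] H) (R : V →L[ℂ] K) (M : K →L[ℂ] K) {c : ℝ≥0} (hc : 0 < c)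
    (hG : ∀ w, ‖w‖ ^ 2 * c ≤ ‖G w‖ ^ 2) :
    ∃ A : K →L[ℂ] V, ∀ h w,
      (∀ φ, inner ℂ (G φ) (G w) = - inner ℂ (R φ) (M h)) ↔ w = A h := by
  have hunit : IsUnit ((ContinuousLinearMap.adjoint G).comp G) := by
    refine ContinuousLinearMap.isUnit_of_forall_le_norm_inner_map _ hc fun w => ?_
    rw [ContinuousLinearMap.comp_apply, ContinuousLinearMap.adjoint_inner_left,
      inner_self_eq_norm_sq_to_K, norm_pow, RCLike.norm_ofReal, abs_norm]
    exact hG w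
  obtain ⟨S, hS⟩ := hunit
  have hinv1 : ∀ w, (S.inv : V →L[ℂ] V) ((S.val : V →L[ℂ] V) w) = w := fun w =>
    congrArg (fun L : V →L[ℂ] V => L w) S.inv_val
  have hinv2 : ∀ w, (S.val : V →L[ℂ] V) ((S.inv : V →L[ℂ] V) w) = w := fun w =>
    congrArg (fun L : V →L[ℂ] V => L w) S.val_inv
  refine ⟨-((S.inv : V →L[ℂ] V).comp ((ContinuousLinearMap.adjoint R).comp M)),
    fun h w => ?_⟩
  have hSw : ∀ φ, inner ℂ (G φ) (G w) = inner ℂ φ ((S.val : V →L[ℂ] V) w) := fun φ => by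
    rw [hS, ContinuousLinearMap.comp_apply, ContinuousLinearMap.adjoint_inner_right]
  have hRM : ∀ φ, - inner ℂ (R φ) (M h) = inner ℂ φ (-(ContinuousLinearMap.adjoint R (M h))) :=
    fun φ => by rw [inner_neg_right, ContinuousLinearMap.adjoint_inner_right]
  simp only [hSw, hRM]
  constructor
  · intro hw
    rw [← hinv1 w, ext_inner_left ℂ hw, map_neg]
    rfl
  · rintro rfl φ
    simp only [neg_apply, ContinuousLinearMap.comp_apply, map_neg, hinv2]

/-- Testing the variational equation with its solution gives the energy identity. -/
lemma energy_identity {V H K : Type*}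
    [NormedAddCommGroup V] [InnerProductSpace ℂ V] [NormedAddCommGroup H] [InnerProductSpace ℂ H]
    [NormedAddCommGroup K] [InnerProductSpace ℂ K]
    {G : V →L[ℂ] H} {R : V →L[ℂ] K} {M : K →L[ℂ] K}
    (hM : ∀ h τ, inner ℂ τ (M h) = inner ℂ (M τ) h) {h : K} {w : V}
    (hw : ∀ φ, inner ℂ (G φ) (G w) = - inner ℂ (R φ) (M h)) :
    inner ℂ h (M (h - R w)) = inner ℂ h (M h) + ((‖G w‖ ^ 2 : ℝ) : ℂ) := by
  have h1 : inner ℂ (R w) (M h) = -((‖G w‖ ^ 2 : ℝ) : ℂ) := by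
    have h2 := inner_self_eq_norm_sq_to_K (𝕜 := ℂ) (G w)
    rw [hw w] at h2
    rw [← neg_eq_iff_eq_neg, h2, Complex.ofReal_pow]
    rfl
  rw [map_sub, inner_sub_right, hM (R w), ← inner_conj_symm (M h) (R w), h1, map_neg,
    Complex.conj_ofReal, sub_neg_eq_add]

section Multiplication

variable {α : Type*} [MeasurableSpace α] {μ : Measure α} {γ : α → ℝ}

lemma memLp_top_ofReal {a b : ℝ} (hγm : AEStronglyMeasurable γ μ)
    (hγ : ∀ᵐ x ∂μ, a ≤ γ x ∧ γ x ≤ b) : MemLp (fun x => (γ x : ℂ)) ∞ μ := by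
  refine memLp_top_of_bound (Complex.continuous_ofReal.comp_aestronglyMeasurable hγm)
    (max (-a) b) ?_
  filter_upwards [hγ] with x hx
  rw [Complex.norm_real, Real.norm_eq_abs, abs_le]
  constructor
  · linarith [le_max_left (-a) b]
  · exact hx.2.trans (le_max_right _ _)

/-- Multiplication by a bounded real function, as an operator on `L²`. -/
lemma exists_mulOperator (hγ : MemLp (fun x => (γ x : ℂ)) ∞ μ) :
    ∃ M : Lp ℂ 2 μ →L[ℂ] Lp ℂ 2 μ, ∀ h, M h =ᵐ[μ] fun x => (γ x : ℂ) * h x := by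
  refine ⟨(ContinuousLinearMap.mul ℂ ℂ).holderL μ ∞ 2 2 (hγ.toLp _), fun h => ?_⟩
  filter_upwards [(ContinuousLinearMap.mul ℂ ℂ).coeFn_holder (r := 2) (hγ.toLp _) h,
    hγ.coeFn_toLp] with x hx hx'
  refine hx.trans ?_
  rw [hx', ContinuousLinearMap.mul_apply']

variable {M : Lp ℂ 2 μ →L[ℂ] Lp ℂ 2 μ}

lemma inner_mulOperator (hM : ∀ h, M h =ᵐ[μ] fun x => (γ x : ℂ) * h x) (h τ : Lp ℂ 2 μ) :
    inner ℂ τ (M h) = ∫ x, (γ x : ℂ) * h x * (starRingEnd ℂ) (τ x) ∂μ := by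
  rw [L2.inner_def]
  refine integral_congr_ae ?_
  filter_upwards [hM h] with x hx
  rw [hx, RCLike.inner_apply]

lemma inner_mulOperator_comm (hM : ∀ h, M h =ᵐ[μ] fun x => (γ x : ℂ) * h x) (h τ : Lp ℂ 2 μ) :
    inner ℂ τ (M h) = inner ℂ (M τ) h := by
  rw [L2.inner_def, L2.inner_def]
  refine integral_congr_ae ?_
  filter_upwards [hM h, hM τ] with x hx hx'
  rw [hx, hx', RCLike.inner_apply, RCLike.inner_apply, map_mul, Complex.conj_ofReal]
  ring

lemma inner_mulOperator_self (hM : ∀ h, M h =ᵐ[μ] fun x => (γ x : ℂ) * h x) (h : Lp ℂ 2 μ) :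
    inner ℂ h (M h) = ((∫ x, γ x * ‖h x‖ ^ 2 ∂μ : ℝ) : ℂ) := by
  rw [inner_mulOperator hM, ← integral_complex_ofReal]
  refine integral_congr_ae (Eventually.of_forall fun x => ?_)
  simp only
  rw [mul_assoc, Complex.mul_conj']
  push_cast
  rfl

lemma norm_sq_eq_integral {E : Type*} [NormedAddCommGroup E] [InnerProductSpace ℂ E]
    (h : Lp E 2 μ) : ‖h‖ ^ 2 = ∫ x, ‖h x‖ ^ 2 ∂μ := by
  have h1 : ((‖h‖ ^ 2 : ℝ) : ℂ) = ((∫ x, ‖h x‖ ^ 2 ∂μ : ℝ) : ℂ) := by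
    rw [← integral_complex_ofReal, Complex.ofReal_pow]
    refine (inner_self_eq_norm_sq_to_K (𝕜 := ℂ) h).symm.trans ?_
    rw [L2.inner_def]
    refine integral_congr_ae (Eventually.of_forall fun x => ?_)
    exact (inner_self_eq_norm_sq_to_K (𝕜 := ℂ) (h x)).trans (Complex.ofReal_pow _ _).symm
  exact_mod_cast h1

lemma le_integral_mul_norm_sq {a b : ℝ} (hγm : AEStronglyMeasurable γ μ)
    (hγ : ∀ᵐ x ∂μ, a ≤ γ x ∧ γ x ≤ b) (h : Lp ℂ 2 μ) :
    a * ‖h‖ ^ 2 ≤ ∫ x, γ x * ‖h x‖ ^ 2 ∂μ := by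
  have hint : Integrable (fun x => ‖h x‖ ^ 2) μ := (Lp.memLp h).integrable_norm_pow (by norm_num)
  rw [norm_sq_eq_integral, ← integral_const_mul]
  refine integral_mono_ae (hint.const_mul a) (hint.bdd_mul (c := max (-a) b) hγm ?_) ?_
  · filter_upwards [hγ] with x hx
    rw [Real.norm_eq_abs, abs_le]
    constructor
    · linarith [le_max_left (-a) b]
    · exact hx.2.trans (le_max_right _ _)
  · filter_upwards [hγ] with x hx
    exact mul_le_mul_of_nonneg_right hx.1 (sq_nonneg _)

end Multiplication

lemma norm_gradL_sq {d : ℕ} {Ω : Set (Space d)} (w : H10 Ω) :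
    ‖gradL Ω w‖ ^ 2 = ∫ x in Ω, ‖H1grad w.1 x‖ ^ 2 :=
  norm_sq_eq_integral w.1.1.snd

/-- The transmission problem is equivalent to the variational equation
`(∇w, ∇φ) = - (γ h, φ|_{∂D})` for all `φ ∈ H¹₀(Ω)`. The differential equation is the special case
of test functions `φ` supported away from `∂D`, whose trace vanishes. -/
lemma solvesTransmission_iff {d : ℕ} {Ω D : Set (Space d)} (hΩ : IsOpen Ω)
    (hΩb : Bornology.IsBounded Ω) (hD : IsOpen D) (hDΩ : closure D ⊆ Ω) (hD2 : HasC2Boundary D)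
    {γ : Space d → ℝ} {M : L2Boundary D →L[ℂ] L2Boundary D}
    (hM : ∀ h, M h =ᵐ[surfaceMeasure D] fun x => (γ x : ℂ) * h x)
    {R : H10 Ω →L[ℂ] L2Boundary D} (hR : ∀ w : H10 Ω, IsTrace D w.1 (R w))
    (h : L2Boundary D) (w : H10 Ω) :
    SolvesTransmission D γ h w.1 ↔
      ∀ φ : H10 Ω, inner ℂ (gradL Ω φ) (gradL Ω w) = - inner ℂ (R φ) (M h) := by
  have h0 : volume (frontier D) = 0 :=
    volume_frontier_eq_zero hD (hΩb.subset (subset_closure.trans hDΩ)) hD2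
  constructor
  · intro hw φ
    have h1 := hw.jump φ.1 φ.2 (R φ) (hR φ)
    rw [normal_jump_eq hD hDΩ h0 φ w, ← inner_mulOperator hM h (R φ)] at h1
    exact neg_eq_iff_eq_neg.1 h1
  · intro hw
    refine ⟨w.2, fun φ hφ => ?_, fun φ hφ τ hτ => ?_⟩
    · obtain ⟨u, hu, huφ⟩ := (hφ.mono Set.sdiff_subset).exists_H1 hΩ
      have hu0 : IsTrace D u 0 :=
        isTrace_zero_of_forall_frontier hφ.smooth.contDiffOn huφ fun x hx =>
          image_eq_zero_of_notMem_tsupport fun h => (hφ.support_subset h).2 hx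
      have hRu : R ⟨u, hu⟩ = 0 := (hR ⟨u, hu⟩).unique hΩ hΩb hD hDΩ hD2 hu0
      have hinner : inner ℂ (R ⟨u, hu⟩) (M h) = (0 : ℂ) := by
        rw [hRu]
        exact inner_zero_left _
      have h1 : ∫ x in Ω, inner ℂ (H1grad u x) (H1grad w.1 x) = (0 : ℂ) :=
        (inner_gradL ⟨u, hu⟩ w).symm.trans ((hw ⟨u, hu⟩).trans (by rw [hinner, neg_zero]))
      rw [setIntegral_diff_frontier h0]
      refine Eq.trans (integral_congr_ae ?_) h1
      filter_upwards [H1grad_ae_eq_classicalGrad hΩ hφ.smooth.contDiffOn huφ] with x hx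
      rw [hx]
    · have hτR : τ = R ⟨φ, hφ⟩ := hτ.unique hΩ hΩb hD hDΩ hD2 (hR ⟨φ, hφ⟩)
      refine (normal_jump_eq hD hDΩ h0 ⟨φ, hφ⟩ w).trans ?_
      rw [hw ⟨φ, hφ⟩, neg_neg, ← hτR]
      exact inner_mulOperator hM h τ

end RobinTransmission

end

open RobinTransmission
theorem theorem4p3 (d : ℕ) (hd : 2 ≤ d) (Ω D : Set (Space d))
    (hΩ : IsOpen Ω) (hΩb : Bornology.IsBounded Ω)
    (hD : IsOpen D) (hDΩ : closure D ⊆ Ω) (hD2 : HasC2Boundary D)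
    (γ : Space d → ℝ) (γmin γmax : ℝ)
    (hγm : AEStronglyMeasurable γ (surfaceMeasure D)) (hγmin : 0 < γmin)
    (hγ : ∀ᵐ x ∂(surfaceMeasure D), γmin ≤ γ x ∧ γ x ≤ γmax) :
    -- every function in `H¹₀(Ω)` has exactly one trace on `∂D`
    (∀ w ∈ H10 Ω, ∃! τ : L2Boundary D, IsTrace D w τ) ∧
    -- for every `h ∈ L²(∂D)` the transmission problem has exactly one solution `w`
    (∀ h : L2Boundary D, ∃! w : H1 Ω, SolvesTransmission D γ h w) ∧
    -- `T h = γ (h - w|_{∂D})` is a bounded linear operator on `L²(∂D)`, and it is coercive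
    ∃ T : L2Boundary D →L[ℂ] L2Boundary D,
      (∀ (h : L2Boundary D) (w : H1 Ω) (τ : L2Boundary D),
        SolvesTransmission D γ h w → IsTrace D w τ →
          T h =ᵐ[surfaceMeasure D] fun x => (γ x : ℂ) * (h x - τ x)) ∧
      (∀ (h : L2Boundary D) (w : H1 Ω), SolvesTransmission D γ h w →
        inner ℂ h (T h) =
          (((∫ x, γ x * ‖h x‖ ^ 2 ∂(surfaceMeasure D)) + ∫ x in Ω, ‖H1grad w x‖ ^ 2 : ℝ) : ℂ) ∧
        γmin * ‖h‖ ^ 2 ≤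
          (∫ x, γ x * ‖h x‖ ^ 2 ∂(surfaceMeasure D)) + ∫ x in Ω, ‖H1grad w x‖ ^ 2) ∧
      (∀ h : L2Boundary D, γmin * ‖h‖ ^ 2 ≤ (inner ℂ h (T h)).re) := by
  obtain ⟨R, hR⟩ := exists_traceOperator hΩ hΩb hD hDΩ hD2
  obtain ⟨M, hM⟩ := exists_mulOperator (memLp_top_ofReal hγm hγ)
  obtain ⟨c, hc, hpoincare⟩ := exists_poincare hd hΩ hΩb
  obtain ⟨A, hA⟩ := exists_solutionOperator (V := H10 Ω) (gradL Ω) R M hc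
    fun w => hpoincare w.1 w.2
  have hsolve : ∀ (h : L2Boundary D) (w : H10 Ω), SolvesTransmission D γ h w.1 ↔ w = A h :=
    fun h w => (solvesTransmission_iff hΩ hΩb hD hDΩ hD2 hM hR h w).trans (hA h w)
  have huniq : ∀ (h : L2Boundary D) (w : H1 Ω), SolvesTransmission D γ h w → w = (A h).1 :=
    fun h w hw => congrArg Subtype.val ((hsolve h ⟨w, hw.mem_H10⟩).1 hw)
  have hex : ∀ h : L2Boundary D, SolvesTransmission D γ h (A h).1 := fun h =>
    (hsolve h (A h)).2 rfl
  obtain ⟨T, hT⟩ : ∃ T : L2Boundary D →L[ℂ] L2Boundary D, ∀ h, T h = M (h - R (A h)) :=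
    ⟨M.comp (ContinuousLinearMap.id ℂ _ - R.comp A), fun h => rfl⟩
  have henergy : ∀ h : L2Boundary D, inner ℂ h (T h) =
      (((∫ x, γ x * ‖h x‖ ^ 2 ∂(surfaceMeasure D))
        + ∫ x in Ω, ‖H1grad (A h).1 x‖ ^ 2 : ℝ) : ℂ) := by
    intro h
    have h1 : inner ℂ h (T h) = inner ℂ h (M h) + ((‖gradL Ω (A h)‖ ^ 2 : ℝ) : ℂ) :=
      (congrArg (inner ℂ h) (hT h)).trans
        (energy_identity (V := H10 Ω) (inner_mulOperator_comm hM) ((hA h (A h)).2 rfl))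
    refine h1.trans ?_
    refine Eq.trans ?_ (Complex.ofReal_add _ _).symm
    exact congrArg₂ _ (inner_mulOperator_self hM h) (congrArg _ (norm_gradL_sq (A h)))
  have hbound : ∀ h : L2Boundary D, γmin * ‖h‖ ^ 2 ≤
      (∫ x, γ x * ‖h x‖ ^ 2 ∂(surfaceMeasure D)) + ∫ x in Ω, ‖H1grad (A h).1 x‖ ^ 2 := fun h =>
    (le_integral_mul_norm_sq hγm hγ h).trans
      (le_add_of_nonneg_right (integral_nonneg fun x => sq_nonneg _))
  refine ⟨fun w hw => ⟨R ⟨w, hw⟩, hR ⟨w, hw⟩, fun τ hτ =>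
      hτ.unique hΩ hΩb hD hDΩ hD2 (hR ⟨w, hw⟩)⟩,
    fun h => ⟨(A h).1, hex h, huniq h⟩, T, ?_, ?_, ?_⟩
  · intro h w τ hw hτ
    obtain rfl := huniq h w hw
    obtain rfl : τ = R (A h) := hτ.unique hΩ hΩb hD hDΩ hD2 (hR (A h))
    refine (EventuallyEq.of_eq
      (congrArg (fun f : L2Boundary D => (f : Space d → ℂ)) (hT h))).trans ?_
    filter_upwards [hM (h - R (A h)), Lp.coeFn_sub h (R (A h))] with x hx hx'
    exact hx.trans (congrArg _ hx')
  · intro h w hw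
    obtain rfl := huniq h w hw
    exact ⟨henergy h, hbound h⟩
  · intro h
    rw [henergy h, Complex.ofReal_re]
    exact hbound h
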